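/- Let $X$ be a (nonempty) complete locally compact length space and let $\delta>0$. For an open covering $\mathcal U$ of $X$ and $p\in X$ let $\pi_1(X,\mathcal U,p)$ be the normal subgroup of $\pi_1(X,p)$ generated by the classes of the loops $\alpha\cdot\beta\cdot\alpha^{-1}$, where $\beta$ is a loop lying in some element of $\mathcal U$ and $\alpha$ is a path from $p$ to $\beta(0)$; the Spanier cover $\tilde X_{\mathcal U}$ is the covering space of $X$ with covering group $\pi_1(X,\mathcal U,p)$, with its natural base point over $p$ and with the length metric lifted from $X$. The $\delta$-cover $\tilde X^\delta$ is the Spanier cover of the covering of $X$ by all open balls of radius $\delta$, and, for $x\in X$ and $R>0$, the $R$ cut-off $\delta$-cover based at $x$, $\tilde X^{\delta,R}_{cut\,x}$, is the Spanier cover of the covering by all open balls of radius $\delta$ together with $X\setminus\bar B_x(R)$; both are pointed by the base point over $x$. Then there are a complete locally compact length space $\tilde X^\delta_{cut}$ and a covering map $q:\tilde X^\delta_{cut}\to X$, which do not depend on a base point, such that for every $x\in X$ there is a point $z\in q^{-1}(x)$ with the following properties. 1. As $R\to\infty$, the spaces $\tilde X^{\delta,R}_{cut\,x}$ converge to $(\tilde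 X^\delta_{cut},z)$ in the pointed Gromov–Hausdorff sense. 2. This limit is unique: every pointed proper metric space $(W,w)$ that is the pointed Gromov–Hausdorff limit of $\tilde X^{\delta,R}_{cut\,x}$ as $R\to\infty$ is isometric to $(\tilde X^\delta_{cut},z)$ by an isometry taking $z$ to $w$. 3. There are base point preserving covering maps $$\tilde X^\delta\longrightarrow \tilde X^\delta_{cut}\longrightarrow \tilde X^{\delta,R}_{cut\,x}\qquad\text{for every } R>0,$$ compatible with the projections to $X$. Here all covering maps are surjective and local isometries. The pointed spaces $(Y_R,y_R)$ converge to $(Z,z)$ in the pointed Gromov–Hausdorff sense if for all $r,\varepsilon>0$ and all sufficiently large $R$ there is a map $f:\bar B_{y_R}(r)\to\bar B_z(r)$ with $f(y_R)=z$ that changes distances by less than $\varepsilon$ and whose image is $\varepsilon$-dense. -/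

import Mathlib

open Set Filter Topology Metric
open scoped ENNReal unitInterval

universe u

noncomputable section

/-! ### Length spaces -/

/-- The length of a curve: its total variation, in `[0, ∞]`. -/
def pathLength {X : Type u} [PseudoEMetricSpace X] {x y : X} (c : Path x y) : ℝ≥0∞ :=
  eVariationOn c univ

/-- A length space: the distance between two points is the infimum of the lengths of the
curves running between them (as the distance is finite, there is a rectifiable such curve). -/
class IsLengthSpace (X : Type u) [MetricSpace X] : Prop where
  edist_eq_iInf : ∀ x y : X, edist x y = ⨅ c : Path x y, pathLength c

section PathLength

variable {X : Type u} [PseudoEMetricSpace X] {x y z : X}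

theorem pathLength_refl (x : X) : pathLength (Path.refl x) = 0 := by
  refine eVariationOn.constant_on ?_
  rintro _ ⟨s, -, rfl⟩ _ ⟨t, -, rfl⟩
  simp

theorem pathLength_symm_le (c : Path x y) : pathLength c.symm ≤ pathLength c := by
  refine eVariationOn.comp_le_of_antitoneOn (f := c) (s := univ) (t := univ) unitInterval.symm
    ?_ (fun _ _ => mem_univ _)
  intro a _ b _ hab
  exact unitInterval.symm_le_symm.2 hab

theorem pathLength_symm (c : Path x y) : pathLength c.symm = pathLength c :=
  le_antisymm (pathLength_symm_le c) (by simpa using pathLength_symm_le c.symm)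

theorem edist_le_pathLength (c : Path x y) (s t : I) : edist (c s) (c t) ≤ pathLength c :=
  eVariationOn.edist_le _ (mem_univ _) (mem_univ _)

theorem edist_ends_le_pathLength (c : Path x y) : edist x y ≤ pathLength c := by
  simpa using edist_le_pathLength c 0 1

theorem pathLength_trans_le (c : Path x y) (d : Path y z) :
    pathLength (c.trans d) ≤ pathLength c + pathLength d := by
  let h : I := ⟨1 / 2, by norm_num, by norm_num⟩
  have hU : (univ : Set I) = Iic h ∪ Ici h := by
    ext t; simp
  have h1 : eVariationOn (c.trans d) univ
      = eVariationOn (c.trans d) (Iic h) + eVariationOn (c.trans d) (Ici h) := by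
    rw [hU]
    exact eVariationOn.union _ (x := h) isGreatest_Iic isLeast_Ici
  unfold pathLength
  rw [h1]
  refine add_le_add ?_ ?_
  · let φ : I → I := fun t => Set.projIcc 0 1 zero_le_one (2 * (t : ℝ))
    have : EqOn (c.trans d) (c ∘ φ) (Iic h) := by
      intro t ht
      have ht' : (t : ℝ) ≤ 1 / 2 := ht
      simp only [Path.trans, Function.comp, Path.coe_mk', ContinuousMap.coe_mk]
      rw [if_pos ht']
      rfl
    rw [eVariationOn.congr this]
    refine eVariationOn.comp_le_of_monotoneOn (f := c) (s := univ) φ ?_ (fun _ _ => mem_univ _)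
    intro a _ b _ hab
    refine Set.monotone_projIcc _ ?_
    have : (a : ℝ) ≤ b := hab
    linarith
  · let φ : I → I := fun t => Set.projIcc 0 1 zero_le_one (2 * (t : ℝ) - 1)
    have : EqOn (c.trans d) (d ∘ φ) (Ici h) := by
      intro t ht
      have ht' : 1 / 2 ≤ (t : ℝ) := ht
      have := Path.extend_trans_of_half_le c d ht'
      rw [Path.extend_apply _ t.2] at this
      exact this
    rw [eVariationOn.congr this]
    refine eVariationOn.comp_le_of_monotoneOn (f := d) (s := univ) φ ?_ (fun _ _ => mem_univ _)
    intro a _ b _ hab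
    refine Set.monotone_projIcc _ ?_
    have : (a : ℝ) ≤ b := hab
    linarith

end PathLength

/-! ### Spanier covers -/

/-- A collection of open sets covering `X`. -/
structure OpenCovering (X : Type u) [TopologicalSpace X] where
  /-- the members of the covering -/
  sets : Set (Set X)
  isOpen : ∀ U ∈ sets, IsOpen U
  covers : ∀ x : X, ∃ U ∈ sets, x ∈ U

section Spanier

variable {X : Type u}

/-- The subgroup `π₁(X, 𝒰, p)` of `π₁(X, p)` generated by the classes of the loops
`α · β · α⁻¹` (first `α`, then `β`, then `α` backwards), where `β` is a loop lying in some member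
of `𝒰` and `α` is a path from `p` to the base point of `β`. The set of generators is invariant
under conjugation, so the subgroup is normal. -/
def spanierSubgroup [TopologicalSpace X] (𝒰 : OpenCovering X) (p : X) :
    Subgroup (FundamentalGroup X p) :=
  Subgroup.closure
    {g | ∃ (y : X) (α : Path p y) (β : Path y y), (∃ U ∈ 𝒰.sets, range β ⊆ U) ∧
      g = FundamentalGroup.fromPath (Path.Homotopic.Quotient.mk ((α.trans β).trans α.symm))}

/-- Two paths from `p` to `y` are identified when the loop formed by the first one and the
reverse of the second one represents an element of `π₁(X, 𝒰, p)`. -/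
def spanierSetoid [TopologicalSpace X] (𝒰 : OpenCovering X) (p y : X) : Setoid (Path p y) where
  r γ γ' := FundamentalGroup.fromPath (Path.Homotopic.Quotient.mk (γ.trans γ'.symm)) ∈
    spanierSubgroup 𝒰 p
  iseqv := by
    refine ⟨fun γ => ?_, fun {γ γ'} h => ?_, fun {γ γ' γ''} h h' => ?_⟩
    · have : FundamentalGroup.fromPath (Path.Homotopic.Quotient.mk (γ.trans γ.symm)) = 1 := by
        rw [FundamentalGroup.one_def]; simp
      rw [this]; exact one_mem _
    · have : FundamentalGroup.fromPath (Path.Homotopic.Quotient.mk (γ'.trans γ.symm)) =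
          (FundamentalGroup.fromPath (Path.Homotopic.Quotient.mk (γ.trans γ'.symm)))⁻¹ := by
        rw [FundamentalGroup.inv_def]
        change Path.Homotopic.Quotient.mk _ = Path.Homotopic.Quotient.mk (γ.trans γ'.symm).symm
        simp
      rw [this]; exact inv_mem h
    · have : FundamentalGroup.fromPath (Path.Homotopic.Quotient.mk (γ.trans γ''.symm)) =
          FundamentalGroup.fromPath (Path.Homotopic.Quotient.mk (γ'.trans γ''.symm)) *
          FundamentalGroup.fromPath (Path.Homotopic.Quotient.mk (γ.trans γ'.symm)) := by
        rw [FundamentalGroup.mul_def]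
        simp only [FundamentalGroup.fromPath, FundamentalGroup.fromArrow,
          Path.Homotopic.Quotient.mk_trans, Path.Homotopic.Quotient.mk_symm,
          Path.Homotopic.Quotient.trans_assoc]
        rw [← Path.Homotopic.Quotient.trans_assoc (Path.Homotopic.Quotient.mk γ').symm,
          Path.Homotopic.Quotient.symm_trans, Path.Homotopic.Quotient.refl_trans]
      rw [this]; exact mul_mem h' h

/-- The Spanier cover `X̃_𝒰` of `X` with covering group `π₁(X, 𝒰, p)`: its points are the paths
starting at `p`, two of them being identified when they have the same end point and differ by an
element of `π₁(X, 𝒰, p)`. -/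
structure SpanierCover [TopologicalSpace X] (𝒰 : OpenCovering X) (p : X) : Type u where
  /-- the covering projection -/
  proj : X
  /-- the class of a path from `p` to the projection -/
  pathClass : Quotient (spanierSetoid 𝒰 p proj)

namespace SpanierCover

section Topological

variable [TopologicalSpace X] {𝒰 : OpenCovering X} {p : X}

/-- The point of the cover determined by a path starting at `p`. -/
def mk' {y : X} (γ : Path p y) : SpanierCover 𝒰 p := ⟨y, Quotient.mk _ γ⟩

/-- The base point of the cover: the class of the constant path. It lies over `p`. -/
def base (𝒰 : OpenCovering X) (p : X) : SpanierCover 𝒰 p := mk' (Path.refl p)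

theorem exists_rep (e : SpanierCover 𝒰 p) : ∃ γ : Path p e.proj, e = mk' γ := by
  obtain ⟨y, q⟩ := e
  obtain ⟨γ, rfl⟩ := Quotient.exists_rep q
  exact ⟨γ, rfl⟩

theorem spanierSetoid_trans {y z : X} {γ γ' : Path p y} (h : spanierSetoid 𝒰 p y γ γ')
    (c : Path y z) : spanierSetoid 𝒰 p z (γ.trans c) (γ'.trans c) := by
  change FundamentalGroup.fromPath _ ∈ _
  change FundamentalGroup.fromPath _ ∈ _ at h
  convert h using 1
  simp only [FundamentalGroup.fromPath, FundamentalGroup.fromArrow, Path.trans_symm,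
    Path.Homotopic.Quotient.mk_trans, Path.Homotopic.Quotient.mk_symm,
    Path.Homotopic.Quotient.trans_assoc]
  rw [← Path.Homotopic.Quotient.trans_assoc (Path.Homotopic.Quotient.mk c),
    Path.Homotopic.Quotient.trans_symm, Path.Homotopic.Quotient.refl_trans]

/-- The end point of the lift, starting at the point `e` of the cover, of a path `c` in `X`. -/
def transport (e : SpanierCover 𝒰 p) {z : X} (c : Path e.proj z) : SpanierCover 𝒰 p :=
  ⟨z, Quotient.map' (s₁ := spanierSetoid 𝒰 p e.proj) (s₂ := spanierSetoid 𝒰 p z)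
    (fun γ => γ.trans c) (fun _ _ h => spanierSetoid_trans h c) e.pathClass⟩

theorem transport_mk' {y z : X} (γ : Path p y) (c : Path y z) :
    (mk' γ : SpanierCover 𝒰 p).transport c = mk' (γ.trans c) := rfl

theorem mk'_eq_of_homotopic {y : X} {γ γ' : Path p y} (h : γ.Homotopic γ') :
    (mk' γ : SpanierCover 𝒰 p) = mk' γ' := by
  unfold mk'
  congr 1
  refine Quotient.sound ?_
  change FundamentalGroup.fromPath _ ∈ _
  have : FundamentalGroup.fromPath (Path.Homotopic.Quotient.mk (γ.trans γ'.symm)) = 1 := by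
    rw [FundamentalGroup.one_def]
    simp only [Path.Homotopic.Quotient.mk_trans, Path.Homotopic.Quotient.mk_symm,
      Path.Homotopic.Quotient.eq.2 h, Path.Homotopic.Quotient.trans_symm]
  rw [this]; exact one_mem _

theorem transport_congr (e : SpanierCover 𝒰 p) {z : X} {c c' : Path e.proj z}
    (h : c.Homotopic c') : e.transport c = e.transport c' := by
  obtain ⟨y, q⟩ := e
  obtain ⟨γ, rfl⟩ := Quotient.exists_rep q
  exact mk'_eq_of_homotopic ((Path.Homotopic.refl γ).hcomp h)

theorem transport_eq_of_eq {e e' : SpanierCover 𝒰 p} (he : e = e') {z z' : X}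
    (c : Path e.proj z) (c' : Path e'.proj z') (h : ∀ t, c t = c' t) :
    e.transport c = e'.transport c' := by
  subst he
  have : z = z' := by simpa using h 1
  subst this
  have : c = c' := by ext t; exact h t
  rw [this]

theorem transport_refl (e : SpanierCover 𝒰 p) : e.transport (Path.refl e.proj) = e := by
  obtain ⟨y, q⟩ := e
  obtain ⟨γ, rfl⟩ := Quotient.exists_rep q
  exact mk'_eq_of_homotopic (Path.Homotopic.trans_refl γ)

theorem transport_trans (e : SpanierCover 𝒰 p) {z w : X} (c : Path e.proj z) (d : Path z w) :
    e.transport (c.trans d) = (e.transport c).transport d := by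
  obtain ⟨y, q⟩ := e
  obtain ⟨γ, rfl⟩ := Quotient.exists_rep q
  exact (mk'_eq_of_homotopic (Path.Homotopic.trans_assoc γ c d)).symm

theorem transport_symm (e : SpanierCover 𝒰 p) {z : X} (c : Path e.proj z) :
    (e.transport c).transport c.symm = e := by
  rw [← transport_trans, transport_congr e (Path.Homotopic.trans_symm c), transport_refl]

theorem transport_loop (e : SpanierCover 𝒰 p) (c : Path e.proj e.proj) {U : Set X}
    (hU : U ∈ 𝒰.sets) (hc : range c ⊆ U) : e.transport c = e := by
  obtain ⟨y, q⟩ := e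
  obtain ⟨γ, rfl⟩ := Quotient.exists_rep q
  change SpanierCover.mk _ _ = SpanierCover.mk _ _
  congr 1
  refine Quotient.sound ?_
  exact Subgroup.subset_closure ⟨y, γ, c, ⟨U, hU, hc⟩, rfl⟩

theorem transport_eq_of_range (e : SpanierCover 𝒰 p) {z : X} (c c' : Path e.proj z) {U : Set X}
    (hU : U ∈ 𝒰.sets) (hc : range c ⊆ U) (hc' : range c' ⊆ U) :
    e.transport c = e.transport c' := by
  have h1 : e.transport (c.trans c'.symm) = e := by
    refine transport_loop e _ hU ?_
    rw [Path.trans_range, Path.symm_range]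
    exact union_subset hc hc'
  have h2 := transport_symm (e.transport c) c'.symm
  refine h2.symm.trans (transport_eq_of_eq ?_ _ _
    (fun t => congrArg (fun d => d t) (Path.symm_symm c')))
  exact (transport_trans e c c'.symm).symm.trans h1

end Topological

section Metric

variable [MetricSpace X] {𝒰 : OpenCovering X} {p : X}

/-- The lifted length distance on the cover: the infimum, over all curves from `e` to `e'`, of the
length of their projection to `X`. A curve in the cover from `e` to `e'` is given by a
path in `X` whose lift starting at `e` ends at `e'`. -/
instance : EDist (SpanierCover 𝒰 p) where
  edist e e' := ⨅ (c : Path e.proj e'.proj) (_ : e.transport c = e'), pathLength c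

theorem edist_def (e e' : SpanierCover 𝒰 p) :
    edist e e' = ⨅ (c : Path e.proj e'.proj) (_ : e.transport c = e'), pathLength c := rfl

theorem edist_transport_le (e : SpanierCover 𝒰 p) {z : X} (c : Path e.proj z) :
    edist e (e.transport c) ≤ pathLength c :=
  iInf₂_le (f := fun (c' : Path e.proj (e.transport c).proj)
    (_ : e.transport c' = e.transport c) => pathLength c') c rfl

theorem exists_of_edist_lt {e e' : SpanierCover 𝒰 p} {r : ℝ≥0∞} (h : edist e e' < r) :
    ∃ c : Path e.proj e'.proj, e.transport c = e' ∧ pathLength c < r := by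
  rw [edist_def] at h
  simpa only [iInf_lt_iff, exists_prop] using h

theorem edist_proj_le (e e' : SpanierCover 𝒰 p) : edist e.proj e'.proj ≤ edist e e' :=
  le_iInf₂ fun c _ => edist_ends_le_pathLength c

theorem edist_comm_le (e e' : SpanierCover 𝒰 p) : edist e' e ≤ edist e e' := by
  refine le_iInf₂ fun c hc => ?_
  have h := transport_symm e c
  have h2 : e'.transport c.symm = e :=
    (transport_eq_of_eq hc.symm c.symm (z' := e.proj) c.symm (fun _ => rfl)).trans h
  calc edist e' e ≤ pathLength c.symm := iInf₂_le (f := fun (c' : Path e'.proj e.proj)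
        (_ : e'.transport c' = e) => pathLength c') c.symm h2
    _ = pathLength c := pathLength_symm c

theorem edist_triangle_aux (e e' e'' : SpanierCover 𝒰 p) :
    edist e e'' ≤ edist e e' + edist e' e'' := by
  refine ENNReal.le_of_forall_pos_le_add fun ε hε hfin => ?_
  have hfin' := ENNReal.add_lt_top.1 hfin
  have hε2 : ((ε / 2 : NNReal) : ℝ≥0∞) ≠ 0 := by
    have : (ε / 2 : NNReal) ≠ 0 := (half_pos hε).ne'
    exact_mod_cast this
  obtain ⟨c, hc, hcl⟩ := exists_of_edist_lt (ENNReal.lt_add_right hfin'.1.ne hε2)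
  obtain ⟨d, hd, hdl⟩ := exists_of_edist_lt (ENNReal.lt_add_right hfin'.2.ne hε2)
  have hcd : e.transport (c.trans d) = e'' := by
    rw [transport_trans]
    exact (transport_eq_of_eq hc (z := e''.proj) d d (fun _ => rfl)).trans hd
  calc edist e e'' ≤ pathLength (c.trans d) := iInf₂_le (f := fun (c' : Path e.proj e''.proj)
        (_ : e.transport c' = e'') => pathLength c') _ hcd
    _ ≤ pathLength c + pathLength d := pathLength_trans_le c d
    _ ≤ (edist e e' + (ε / 2 : NNReal)) + (edist e' e'' + (ε / 2 : NNReal)) :=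
        add_le_add hcl.le hdl.le
    _ = edist e e' + edist e' e'' + ε := by
        rw [add_add_add_comm, ← ENNReal.coe_add, add_halves]

theorem eq_of_edist_eq_zero_aux (e e' : SpanierCover 𝒰 p) (h : edist e e' = 0) : e = e' := by
  have hp : e.proj = e'.proj := by
    have := edist_proj_le e e'
    rw [h] at this
    exact edist_le_zero.1 this
  obtain ⟨U, hU, hxU⟩ := 𝒰.covers e.proj
  obtain ⟨r, hr, hrU⟩ := EMetric.isOpen_iff.1 (𝒰.isOpen U hU) _ hxU
  obtain ⟨c, hc, hcl⟩ := exists_of_edist_lt (h.trans_lt hr)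
  rw [← hc]
  have h2 : e.transport c = e.transport (c.cast rfl hp) :=
    transport_eq_of_eq rfl _ _ (fun _ => rfl)
  rw [h2]
  refine (transport_loop e _ hU ?_).symm
  rintro _ ⟨t, rfl⟩
  refine hrU ?_
  have := edist_le_pathLength c t 0
  rw [c.source] at this
  exact this.trans_lt hcl

instance : EMetricSpace (SpanierCover 𝒰 p) where
  edist_self e := by
    refine le_antisymm ?_ zero_le
    have := edist_transport_le e (Path.refl e.proj)
    rwa [transport_refl, pathLength_refl] at this
  edist_comm e e' := le_antisymm (edist_comm_le e' e) (edist_comm_le e e')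
  edist_triangle := edist_triangle_aux
  eq_of_edist_eq_zero := fun {e e'} h => eq_of_edist_eq_zero_aux e e' h

variable [IsLengthSpace X]

theorem edist_transport_lt_top_of_range (e : SpanierCover 𝒰 p) {U : Set X} (hU : U ∈ 𝒰.sets)
    {r : ℝ≥0∞} (hrU : Metric.eball e.proj r ⊆ U) {z : X} (c : Path e.proj z)
    (hc : range c ⊆ Metric.eball e.proj r) : edist e (e.transport c) < ⊤ := by
  have hz : edist e.proj z < r := by
    have : z ∈ Metric.eball e.proj r := hc ⟨1, by simp⟩
    rw [edist_comm]; exact this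
  rw [IsLengthSpace.edist_eq_iInf, iInf_lt_iff] at hz
  obtain ⟨c', hc'⟩ := hz
  have hr' : range c' ⊆ Metric.eball e.proj r := by
    rintro _ ⟨t, rfl⟩
    have := edist_le_pathLength c' t 0
    rw [c'.source] at this
    exact this.trans_lt hc'
  rw [transport_eq_of_range e c c' hU (hc.trans hrU) (hr'.trans hrU)]
  exact (edist_transport_le e c').trans_lt (hc'.trans_le le_top)

theorem edist_transport_lt_top (e : SpanierCover 𝒰 p) {z : X} (c : Path e.proj z) :
    edist e (e.transport c) < ⊤ := by
  let E : I → SpanierCover 𝒰 p := fun t =>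
    e.transport ((c.subpath 0 t).cast c.source.symm rfl)
  have hE : ∀ t s, E s = (E t).transport (c.subpath t s) := by
    intro t s
    rw [← transport_trans]
    refine (transport_congr e ?_).symm
    exact Path.Homotopic.pathCast ⟨Path.Homotopy.subpathTransSubpath c 0 t s⟩ c.source.symm rfl
  have hloc : ∀ t, ∀ᶠ s in 𝓝 t, edist (E t) (E s) < ⊤ := by
    intro t
    obtain ⟨U, hU, hxU⟩ := 𝒰.covers (c t)
    obtain ⟨r, hr, hrU⟩ := EMetric.isOpen_iff.1 (𝒰.isOpen U hU) _ hxU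
    have hopen : c ⁻¹' Metric.eball (c t) r ∈ 𝓝 t :=
      c.continuous.continuousAt.preimage_mem_nhds (Metric.eball_mem_nhds _ hr)
    obtain ⟨ε, hε, hball⟩ := Metric.mem_nhds_iff.1 hopen
    filter_upwards [Metric.ball_mem_nhds t hε] with s hs
    rw [hE t s]
    refine edist_transport_lt_top_of_range (E t) hU hrU _ ?_
    change range (c.subpath t s) ⊆ Metric.eball (c t) r
    rw [Path.range_subpath]
    rintro _ ⟨w, hw, rfl⟩
    refine hball ?_
    have h1 : dist (w : ℝ) t ≤ dist (s : ℝ) t := by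
      have hw' : (w : ℝ) ∈ uIcc (t : ℝ) s := by
        rcases le_total t s with h | h
        · rw [uIcc_of_le h] at hw
          rw [uIcc_of_le (show (t : ℝ) ≤ s from h)]; exact hw
        · rw [uIcc_of_ge h] at hw
          rw [uIcc_of_ge (show (s : ℝ) ≤ t from h)]; exact hw
      rw [Real.dist_eq, Real.dist_eq]
      exact abs_sub_left_of_mem_uIcc hw'
    exact lt_of_le_of_lt h1 hs
  have hclopen : IsClopen {t | edist e (E t) < ⊤} := by
    constructor
    · rw [← isOpen_compl_iff, isOpen_iff_mem_nhds]
      intro t ht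
      filter_upwards [hloc t] with s hs hs'
      refine ht ((edist_triangle e (E s) (E t)).trans_lt (ENNReal.add_lt_top.2 ⟨hs', ?_⟩))
      rw [edist_comm]; exact hs
    · rw [isOpen_iff_mem_nhds]
      intro t ht
      filter_upwards [hloc t] with s hs
      exact (edist_triangle e (E t) (E s)).trans_lt (ENNReal.add_lt_top.2 ⟨ht, hs⟩)
  have h0 : E 0 = e := by
    rw [← transport_refl e]
    refine transport_eq_of_eq rfl _ _ (fun t => ?_)
    simp
  have h1 : E 1 = e.transport c := by
    refine transport_eq_of_eq rfl _ _ (fun t => ?_)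
    simp
  have huniv := hclopen.eq_univ ⟨0, by simp [h0]⟩
  have : (1 : I) ∈ {t | edist e (E t) < ⊤} := by rw [huniv]; trivial
  rw [← h1]; exact this

theorem edist_ne_top_aux (e e' : SpanierCover 𝒰 p) : edist e e' ≠ ⊤ := by
  have h : ∀ e : SpanierCover 𝒰 p, edist (base 𝒰 p) e < ⊤ := by
    intro e
    obtain ⟨γ, hγ⟩ := exists_rep e
    have := edist_transport_lt_top (base 𝒰 p) (z := e.proj) γ
    have h2 : (base 𝒰 p).transport (z := e.proj) γ = e := by
      conv_rhs => rw [hγ]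
      exact mk'_eq_of_homotopic (Path.Homotopic.refl_trans γ)
    rwa [h2] at this
  refine ((edist_triangle_left e e' (base 𝒰 p)).trans_lt (ENNReal.add_lt_top.2 ⟨h e, h e'⟩)).ne

/-- Over a length space the lifted length distance is finite: the cover is a metric space. Its
topology is the one defined by this metric. -/
instance : MetricSpace (SpanierCover 𝒰 p) := EMetricSpace.toMetricSpace edist_ne_top_aux

end Metric

end SpanierCover

end Spanier

/-! ### The `δ`-cover and the `R` cut-off `δ`-cover -/

section Covers

variable (X : Type u) [MetricSpace X]

/-- The covering of `X` by all open balls of radius `δ`. -/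
def ballCovering (δ : ℝ) (hδ : 0 < δ) : OpenCovering X where
  sets := {U | ∃ q : X, U = ball q δ}
  isOpen := by rintro _ ⟨q, rfl⟩; exact isOpen_ball
  covers x := ⟨ball x δ, ⟨x, rfl⟩, mem_ball_self hδ⟩

variable {X}

/-- The covering of `X` by all open balls of radius `δ` together with the complement of the closed
ball of radius `R` about `x`. -/
def cutoffCovering (δ : ℝ) (hδ : 0 < δ) (R : ℝ) (x : X) : OpenCovering X where
  sets := {U | ∃ q : X, U = ball q δ} ∪ {(closedBall x R)ᶜ}
  isOpen := by
    rintro U (⟨q, rfl⟩ | rfl)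
    · exact isOpen_ball
    · exact isClosed_closedBall.isOpen_compl
  covers y := ⟨ball y δ, Or.inl ⟨y, rfl⟩, mem_ball_self hδ⟩

/-- The `δ`-cover `X̃^δ`, constructed with the paths starting at `x`. -/
abbrev DeltaCover (δ : ℝ) (hδ : 0 < δ) (x : X) : Type u :=
  SpanierCover (ballCovering X δ hδ) x

/-- The `R` cut-off `δ`-cover based at `x`. -/
abbrev CutoffDeltaCover (δ : ℝ) (hδ : 0 < δ) (R : ℝ) (x : X) : Type u :=
  SpanierCover (cutoffCovering δ hδ R x) x

/-- The base point of the `δ`-cover over `x`. -/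
abbrev DeltaCover.base (δ : ℝ) (hδ : 0 < δ) (x : X) : DeltaCover δ hδ x :=
  SpanierCover.base _ x

/-- The base point over `x` of the `R` cut-off `δ`-cover based at `x`. -/
abbrev CutoffDeltaCover.base (δ : ℝ) (hδ : 0 < δ) (R : ℝ) (x : X) : CutoffDeltaCover δ hδ R x :=
  SpanierCover.base _ x

end Covers

/-! ### Metric covering maps and pointed Gromov-Hausdorff convergence -/

/-- A covering map between metric spaces in the metric sense: a surjective covering map that is a
local isometry (the total space carries the metric lifted from the base). -/
structure IsMetricCovering {E B : Type u} [MetricSpace E] [MetricSpace B] (f : E → B) : Prop where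
  isCoveringMap : IsCoveringMap f
  surjective : Function.Surjective f
  isLocalIsometry : ∀ e : E, ∃ r > 0, ∀ a ∈ ball e r, ∀ b ∈ ball e r, dist (f a) (f b) = dist a b

/-- `(Y i, y i)` converges to `(Z, z)` along `l` in the pointed Gromov-Hausdorff sense: for every
`r > 0`, the closed balls of radius `r` about `y i`, with the restricted metric, converge to the
closed ball of radius `r` about `z` through Hausdorff approximations that map centre to centre. -/
def PointedGHTendsto {ι : Type*} (Y : ι → Type u) [∀ i, MetricSpace (Y i)] (y : ∀ i, Y i)
    (l : Filter ι) (Z : Type u) [MetricSpace Z] (z : Z) : Prop :=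
  ∀ r > 0, ∀ ε > 0, ∀ᶠ i in l, ∃ f : closedBall (y i) r → closedBall z r,
    (∀ a : closedBall (y i) r, (a : Y i) = y i → (f a : Z) = z) ∧
    (∀ a b, |dist (f a) (f b) - dist a b| < ε) ∧
    ∀ c : closedBall z r, ∃ a, dist c (f a) < ε

end

/-!
# The cut-off `δ`-cover as a pointed Gromov–Hausdorff limit

A covering space of `X` on which the loops in `δ`-balls lift to loops is determined by a congruence
on the paths of `X`: two paths with the same end points are congruent if their lifts from a common
point end at a common point. The congruences of the cut-off `δ`-covers based at `x` become finer
as `R` grows, since the complements of the balls shrink. The space `X̃^δ_cut` is the one whose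
congruence is their intersection. As every ball about `x` lies in one about any other point `x'`,
the intersection does not depend on `x`. It is coarser than the congruence of the `δ`-cover, hence
the chain of covering maps.

Spaces with a given congruence are treated through the relation "the lift of `c` from `e` ends at
`e'`" (`PathLifting`), so that no base point has to be fixed, and with the length metric lifted
from `X` (`LengthLifting`). Since short loops lift to loops, every map between such spaces that
preserves lifts preserves distances less than `δ` and maps balls of radius `δ` onto such balls
(`LengthLifting.isUniformLocalIsometry`), from which the covering property, completeness and local
compactness follow; the limit space is a length space because lifted paths are continuous and not
longer than their projections (`LengthLifting.exists_path_length_le`). By the Hopf–Rinow theorem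
(`properSpace_of_isLengthSpace`) the limit space is proper.

Convergence: suppose that distinct points `a R`, `b R` of a fixed ball of `X̃^δ_cut` have the same
image in the `R` cut-off cover for arbitrarily large `R`. Limits of `a R` and `b R` have the same
image in every cut-off cover, so they are joined by the lift of a loop that is trivial modulo all
the cut-off congruences, and agree. But then `a R` and `b R` come within `δ` of each other, where
the covering map is injective. So the covering map to the cut-off cover is injective on any given
ball for large `R` (`LengthLifting.exists_injOn_closedBall`), and then, lifting almost shortest
paths, an isometry between concentric balls. The balls are thus eventually isometric to those of the limit,
which gives convergence (`BallsEventuallyIsometric.pointedGHTendsto`). Uniqueness holds because an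
ultrafilter limit of the resulting approximations between proper spaces is an isometry
(`exists_isometryEquiv_of_approx`).
-/

noncomputable section

/-! ### Congruences on paths and spaces with lifting of paths -/

/-- A congruence on the paths of `X`: a relation between paths with the same end points that is
implied by homotopy and compatible with concatenation. Equivalently, a wide normal subgroupoid
of the fundamental groupoid of `X`. -/
structure PathCongruence (X : Type u) [TopologicalSpace X] where
  /-- the relation on the paths from `a` to `b` -/
  rel : ∀ {a b : X}, Path a b → Path a b → Prop
  of_homotopic : ∀ {a b : X} {c c' : Path a b}, c.Homotopic c' → rel c c'
  symm : ∀ {a b : X} {c c' : Path a b}, rel c c' → rel c' c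
  trans : ∀ {a b : X} {c c' c'' : Path a b}, rel c c' → rel c' c'' → rel c c''
  comp : ∀ {a b d : X} {c c' : Path a b} {k k' : Path b d}, rel c c' → rel k k' →
    rel (c.trans k) (c'.trans k')

namespace PathCongruence

variable {X : Type u} [TopologicalSpace X] (K : PathCongruence X)

theorem refl {a b : X} (c : Path a b) : K.rel c c := K.of_homotopic (.refl c)

theorem cancel_left {a b d : X} {c c' : Path a b} {k k' : Path b d} (h : K.rel c c')
    (h' : K.rel (c.trans k) (c'.trans k')) : K.rel k k' := by
  have key : ∀ (c : Path a b) (k : Path b d), K.rel k (c.symm.trans (c.trans k)) := fun c k =>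
    K.of_homotopic <| ((Path.Homotopic.trans_assoc c.symm c k).symm.trans
      (((Path.Homotopic.symm_trans c).hcomp (.refl k)).trans
        (Path.Homotopic.refl_trans k))).symm
  have h1 : K.rel (c.symm.trans (c.trans k)) (c.symm.trans (c'.trans k')) :=
    K.comp (K.refl _) h'
  have h2 : K.rel (c.symm.trans (c'.trans k')) (c.symm.trans (c.trans k')) :=
    K.comp (K.refl _) (K.comp (K.symm h) (K.refl _))
  exact K.trans (K.trans (key c k) h1) (K.trans h2 (K.symm (key c k')))

instance : LE (PathCongruence X) where
  le K K' := ∀ {a b : X} {c c' : Path a b}, K.rel c c' → K'.rel c c'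

/-- The coarsest congruence: all paths with the same end points are related. -/
def total (X : Type u) [TopologicalSpace X] : PathCongruence X where
  rel _ _ := True
  of_homotopic _ := trivial
  symm _ := trivial
  trans _ _ := trivial
  comp _ _ := trivial

/-- The intersection of a family of congruences. -/
def inter {ι : Type*} (K : ι → PathCongruence X) : PathCongruence X where
  rel c c' := ∀ i, (K i).rel c c'
  of_homotopic h i := (K i).of_homotopic h
  symm h i := (K i).symm (h i)
  trans h h' i := (K i).trans (h i) (h' i)
  comp h h' i := (K i).comp (h i) (h' i)

end PathCongruence

/-- A space `E` over `X` in which paths of `X` can be lifted, two paths with the same end points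
having lifts with the same end points exactly when they are congruent modulo `K`. It is described
by the relation `Lift c e e'`: the lift of `c` starting at `e` ends at `e'`. -/
structure PathLifting {X : Type u} [TopologicalSpace X] (K : PathCongruence X) (E : Type u) where
  /-- the projection -/
  proj : E → X
  /-- the lift of the path `c` starting at the first point ends at the second point -/
  Lift : ∀ {a b : X}, Path a b → E → E → Prop
  nonempty : Nonempty E
  proj_source : ∀ {a b : X} {c : Path a b} {e e' : E}, Lift c e e' → proj e = a
  proj_target : ∀ {a b : X} {c : Path a b} {e e' : E}, Lift c e e' → proj e' = b
  exists_lift : ∀ {a b : X} (c : Path a b) (e : E), proj e = a → ∃ e', Lift c e e'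
  exists_path : ∀ e e' : E, ∃ c : Path (proj e) (proj e'), Lift c e e'
  trans : ∀ {a b d : X} {c : Path a b} {k : Path b d} {e e' e'' : E}, Lift c e e' →
    Lift k e' e'' → Lift (c.trans k) e e''
  symm : ∀ {a b : X} {c : Path a b} {e e' : E}, Lift c e e' → Lift c.symm e' e
  unique : ∀ {a b : X} {c : Path a b} {e e' e'' : E}, Lift c e e' → Lift c e e'' → e' = e''
  of_rel : ∀ {a b : X} {c c' : Path a b} {e e' : E}, K.rel c c' → Lift c e e' → Lift c' e e'
  rel : ∀ {a b : X} {c c' : Path a b} {e e' : E}, Lift c e e' → Lift c' e e' → K.rel c c'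

namespace PathLifting

variable {X : Type u} [TopologicalSpace X] {K : PathCongruence X} {E : Type u}

theorem refl (S : PathLifting K E) (e : E) : S.Lift (Path.refl (S.proj e)) e e := by
  obtain ⟨c, hc⟩ := S.exists_path e e
  exact S.of_rel (K.of_homotopic (Path.Homotopic.trans_symm c)) (S.trans hc (S.symm hc))

/-- The path lifting structure of a space of classes of paths starting at `p`: the lift of `c`
starting at the class of `γ` ends at the class of `γ · c`. -/
def ofQuotient (p : X) (proj : E → X) (mk : ∀ {y : X}, Path p y → E)
    (proj_mk : ∀ {y : X} (γ : Path p y), proj (mk γ) = y)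
    (exists_rep : ∀ e, ∃ γ : Path p (proj e), e = mk γ)
    (mk_eq : ∀ {y : X} {γ γ' : Path p y}, mk γ = mk γ' ↔ K.rel γ γ') : PathLifting K E where
  proj := proj
  Lift {a _} c e e' := ∃ γ : Path p a, e = mk γ ∧ e' = mk (γ.trans c)
  nonempty := ⟨mk (Path.refl p)⟩
  proj_source := by rintro a b c _ _ ⟨γ, rfl, rfl⟩; exact proj_mk _
  proj_target := by rintro a b c _ _ ⟨γ, rfl, rfl⟩; exact proj_mk _
  exists_lift := by
    rintro a b c e rfl
    obtain ⟨γ, hγ⟩ := exists_rep e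
    exact ⟨_, γ, hγ, rfl⟩
  exists_path e e' := by
    obtain ⟨γ, hγ⟩ := exists_rep e
    obtain ⟨γ', hγ'⟩ := exists_rep e'
    refine ⟨γ.symm.trans γ', γ, hγ, hγ'.trans (mk_eq.2 (K.of_homotopic ?_))⟩
    exact ((Path.Homotopic.trans_assoc γ γ.symm γ').symm.trans
      (((Path.Homotopic.trans_symm γ).hcomp (.refl γ')).trans
        (Path.Homotopic.refl_trans γ'))).symm
  trans := by
    rintro a b d c k _ _ _ ⟨γ, rfl, rfl⟩ ⟨γ', h, rfl⟩
    refine ⟨γ, rfl, mk_eq.2 (K.trans (K.comp (K.symm (mk_eq.1 h)) (K.refl k))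
      (K.of_homotopic (Path.Homotopic.trans_assoc γ c k)))⟩
  symm := by
    rintro a b c _ _ ⟨γ, rfl, rfl⟩
    refine ⟨γ.trans c, rfl, mk_eq.2 (K.of_homotopic ?_)⟩
    exact ((Path.Homotopic.trans_assoc γ c c.symm).trans
      (((Path.Homotopic.refl γ).hcomp (Path.Homotopic.trans_symm c)).trans
        (Path.Homotopic.trans_refl γ))).symm
  unique := by
    rintro a b c _ _ _ ⟨γ, rfl, rfl⟩ ⟨γ', h, rfl⟩
    exact mk_eq.2 (K.comp (mk_eq.1 h) (K.refl c))
  of_rel := by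
    rintro a b c c' _ _ h ⟨γ, rfl, rfl⟩
    exact ⟨γ, rfl, mk_eq.2 (K.comp (K.refl γ) h)⟩
  rel := by
    rintro a b c c' _ _ ⟨γ, rfl, rfl⟩ ⟨γ', h, h'⟩
    exact K.cancel_left (mk_eq.1 h) (mk_eq.1 h')

/-- A map between spaces with path lifting over `X` that preserves lifts. -/
def IsLiftMap {K' : PathCongruence X} {E' : Type u} (S : PathLifting K E)
    (S' : PathLifting K' E') (f : E → E') : Prop :=
  ∀ ⦃a b : X⦄ ⦃c : Path a b⦄ ⦃e e' : E⦄, S.Lift c e e' → S'.Lift c (f e) (f e')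

/-- Any point of the target over the projection of `e₀` is the image of `e₀` under a map that
preserves lifts: lift the paths that start at `e₀`. -/
theorem exists_map {K' : PathCongruence X} {E' : Type u} (S : PathLifting K E)
    (S' : PathLifting K' E') (hK : K ≤ K') (e₀ : E) (e₀' : E') (h₀ : S'.proj e₀' = S.proj e₀) :
    ∃ f : E → E', f e₀ = e₀' ∧ S.IsLiftMap S' f := by
  have key : ∀ e, ∃ e', ∀ c : Path (S.proj e₀) (S.proj e), S.Lift c e₀ e → S'.Lift c e₀' e' := by
    intro e
    obtain ⟨c, hc⟩ := S.exists_path e₀ e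
    obtain ⟨e', he'⟩ := S'.exists_lift c e₀' h₀
    exact ⟨e', fun c' hc' => S'.of_rel (hK (S.rel hc hc')) he'⟩
  choose f hf using key
  refine ⟨f, S'.unique (hf e₀ _ (S.refl e₀)) ?_, ?_⟩
  · have := S'.refl e₀'
    rwa [h₀] at this
  · intro a b c e e' h
    obtain ⟨k, hk⟩ := S.exists_path e₀ e
    obtain rfl := S.proj_source h
    obtain rfl := S.proj_target h
    have h1 := S'.trans (S'.symm (hf e k hk)) (hf e' _ (S.trans hk h))
    refine S'.of_rel (K'.of_homotopic ?_) h1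
    exact (Path.Homotopic.trans_assoc k.symm k c).symm.trans
      (((Path.Homotopic.symm_trans k).hcomp (.refl c)).trans (Path.Homotopic.refl_trans c))

end PathLifting

/-! ### Spanier covers as spaces with path lifting -/

namespace SpanierCover

variable {X : Type u} [TopologicalSpace X] {𝒰 : OpenCovering X}

theorem mk'_eq_iff {p y : X} {γ γ' : Path p y} :
    (mk' γ : SpanierCover 𝒰 p) = mk' γ' ↔ spanierSetoid 𝒰 p y γ γ' := by
  simp only [mk', SpanierCover.mk.injEq, heq_eq_eq, true_and]
  exact Quotient.eq

theorem mk'_trans_congr {p y z : X} {γ γ' : Path p y}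
    (h : (mk' γ : SpanierCover 𝒰 p) = mk' γ') (c : Path y z) :
    (mk' (γ.trans c) : SpanierCover 𝒰 p) = mk' (γ'.trans c) :=
  mk'_eq_iff.2 (spanierSetoid_trans (mk'_eq_iff.1 h) c)

theorem mk'_eq_of_quotient_eq {p y : X} {γ γ' : Path p y}
    (h : Path.Homotopic.Quotient.mk γ = Path.Homotopic.Quotient.mk γ') :
    (mk' γ : SpanierCover 𝒰 p) = mk' γ' :=
  mk'_eq_of_homotopic (Path.Homotopic.Quotient.eq.1 h)

/-- A loop representing an element of `π₁(X, 𝒰, a)` lifts to loops at every point over `a` of a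
Spanier cover with a different base point. -/
theorem mk'_trans_of_mem {p a : X} (τ : Path p a) {g : FundamentalGroup X a}
    (hg : g ∈ spanierSubgroup 𝒰 a) : ∀ c : Path a a,
      g = FundamentalGroup.fromPath (Path.Homotopic.Quotient.mk c) →
      (mk' (τ.trans c) : SpanierCover 𝒰 p) = mk' τ := by
  have mk_congr : ∀ {c c' : Path a a},
      (FundamentalGroup.fromPath (Path.Homotopic.Quotient.mk c) : FundamentalGroup X a) =
        FundamentalGroup.fromPath (Path.Homotopic.Quotient.mk c') →
      (mk' (τ.trans c) : SpanierCover 𝒰 p) = mk' (τ.trans c') := fun h =>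
    mk'_eq_of_homotopic ((Path.Homotopic.refl τ).hcomp (Path.Homotopic.Quotient.eq.1 h))
  have ex : ∀ g : FundamentalGroup X a, ∃ c : Path a a,
      FundamentalGroup.fromPath (Path.Homotopic.Quotient.mk c) = g := fun g =>
    Path.Homotopic.Quotient.mk_surjective g
  induction hg using Subgroup.closure_induction with
  | mem g hg =>
    obtain ⟨y, α, β, ⟨U, hU, hβ⟩, rfl⟩ := hg
    intro c hc
    have h1 : (mk' ((τ.trans α).trans β) : SpanierCover 𝒰 p) = mk' (τ.trans α) :=
      transport_loop (mk' (τ.trans α)) β hU hβ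
    rw [← mk_congr hc]
    calc (mk' (τ.trans ((α.trans β).trans α.symm)) : SpanierCover 𝒰 p)
        = mk' (((τ.trans α).trans β).trans α.symm) := mk'_eq_of_quotient_eq <| by
          simp only [Path.Homotopic.Quotient.mk_trans, Path.Homotopic.Quotient.trans_assoc]
      _ = mk' ((τ.trans α).trans α.symm) := mk'_trans_congr h1 _
      _ = mk' τ := mk'_eq_of_quotient_eq <| by
          simp only [Path.Homotopic.Quotient.mk_trans, Path.Homotopic.Quotient.mk_symm,
            Path.Homotopic.Quotient.trans_assoc, Path.Homotopic.Quotient.trans_symm,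
            Path.Homotopic.Quotient.trans_refl]
  | one =>
    intro c hc
    rw [← mk_congr (c := Path.refl a) hc]
    exact mk'_eq_of_homotopic (Path.Homotopic.trans_refl τ)
  | mul g h _ _ ihg ihh =>
    intro c hc
    obtain ⟨cg, rfl⟩ := ex g
    obtain ⟨ch, rfl⟩ := ex h
    rw [← mk_congr (c := ch.trans cg) hc,
      ← mk'_eq_of_homotopic (Path.Homotopic.trans_assoc τ ch cg)]
    exact (mk'_trans_congr (ihh ch rfl) cg).trans (ihg cg rfl)
  | inv g _ ihg =>
    intro c hc
    obtain ⟨cg, rfl⟩ := ex g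
    rw [← mk_congr (c := cg.symm) hc, ← mk'_trans_congr (ihg cg rfl)]
    exact mk'_eq_of_quotient_eq <| by
      simp only [Path.Homotopic.Quotient.mk_trans, Path.Homotopic.Quotient.mk_symm,
        Path.Homotopic.Quotient.trans_assoc, Path.Homotopic.Quotient.trans_symm,
        Path.Homotopic.Quotient.trans_refl]

/-- The congruence on paths defined by the Spanier groups of an open covering. -/
def congruence (𝒰 : OpenCovering X) : PathCongruence X where
  rel {a b} c c' := spanierSetoid 𝒰 a b c c'
  of_homotopic h := mk'_eq_iff.1 (mk'_eq_of_homotopic h)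
  symm h := Setoid.symm' _ h
  trans h h' := Setoid.trans' _ h h'
  comp {a b d c c' k k'} h h' := by
    refine Setoid.trans' _ (spanierSetoid_trans h k) (mk'_eq_iff.1 ?_)
    have h1 : (mk' (c'.trans (k.trans k'.symm)) : SpanierCover 𝒰 a) = mk' c' :=
      mk'_trans_of_mem c' h' _ rfl
    refine (mk'_eq_of_quotient_eq ?_).trans (mk'_trans_congr h1 k')
    simp only [Path.Homotopic.Quotient.mk_trans, Path.Homotopic.Quotient.mk_symm,
      Path.Homotopic.Quotient.trans_assoc, Path.Homotopic.Quotient.symm_trans,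
      Path.Homotopic.Quotient.trans_refl]

theorem congruence_mono {𝒰 𝒱 : OpenCovering X} (h : ∀ U ∈ 𝒰.sets, ∃ V ∈ 𝒱.sets, U ⊆ V) :
    congruence 𝒰 ≤ congruence 𝒱 := by
  intro a b c c' hc
  refine Subgroup.closure_mono ?_ hc
  rintro _ ⟨y, α, β, ⟨U, hU, hβ⟩, rfl⟩
  obtain ⟨V, hV, hUV⟩ := h U hU
  exact ⟨y, α, β, ⟨V, hV, hβ.trans hUV⟩, rfl⟩

theorem congruence_rel_of_range {a b : X} {c c' : Path a b} {U : Set X}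
    (hU : U ∈ 𝒰.sets) (hc : range c ⊆ U) (hc' : range c' ⊆ U) : (congruence 𝒰).rel c c' := by
  have h := transport_eq_of_range (mk' (Path.refl a) : SpanierCover 𝒰 a) c c' hU hc hc'
  refine mk'_eq_iff.1 ?_
  rw [← mk'_eq_of_homotopic (Path.Homotopic.refl_trans c),
    ← mk'_eq_of_homotopic (Path.Homotopic.refl_trans c')]
  exact h

/-- The lifting of paths to a Spanier cover. -/
def pathLifting (𝒰 : OpenCovering X) (p : X) :
    PathLifting (congruence 𝒰) (SpanierCover 𝒰 p) :=
  .ofQuotient p proj mk' (fun _ => rfl) exists_rep mk'_eq_iff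

theorem pathLifting_lift_iff {p : X} {e e' : SpanierCover 𝒰 p} {c : Path e.proj e'.proj} :
    (pathLifting 𝒰 p).Lift c e e' ↔ e.transport c = e' := by
  obtain ⟨γ, hγ⟩ := exists_rep e
  have h1 : e.transport c = mk' (γ.trans c) :=
    transport_eq_of_eq hγ c (z' := e'.proj) c (fun _ => rfl)
  rw [h1]
  constructor
  · rintro ⟨γ', h, h'⟩
    refine Eq.trans ?_ h'.symm
    exact mk'_eq_iff.2 (spanierSetoid_trans (mk'_eq_iff.1 (hγ.symm.trans h)) c)
  · exact fun h => ⟨γ, hγ, h.symm⟩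

end SpanierCover

/-! ### Complete locally compact length spaces are proper -/

section LengthSpace

variable {X : Type u} [MetricSpace X]

theorem exists_path_length_lt [IsLengthSpace X] {x y : X} {r : ℝ≥0∞} (h : edist x y < r) :
    ∃ c : Path x y, pathLength c < r := by
  rw [IsLengthSpace.edist_eq_iInf] at h
  exact iInf_lt_iff.1 h

theorem edist_add_edist_le_pathLength {x y : X} (c : Path x y) (t : I) :
    edist x (c t) + edist (c t) y ≤ pathLength c := by
  have h := eVariationOn.Icc_add_Icc c (s := univ) (a := 0) (b := t) (c := 1)
    unitInterval.nonneg' unitInterval.le_one' (mem_univ _)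
  simp only [univ_inter] at h
  calc edist x (c t) + edist (c t) y
      ≤ eVariationOn c (Icc 0 t) + eVariationOn c (Icc t 1) := by
        refine add_le_add ?_ ?_
        · simpa using eVariationOn.edist_le c (left_mem_Icc.2 unitInterval.nonneg')
            (right_mem_Icc.2 (unitInterval.nonneg' (t := t)))
        · simpa using eVariationOn.edist_le c (left_mem_Icc.2 unitInterval.le_one')
            (right_mem_Icc.2 (unitInterval.le_one' (t := t)))
    _ = eVariationOn c (Icc 0 1) := h
    _ ≤ pathLength c := eVariationOn.mono _ (subset_univ _)

theorem exists_dist_lt_dist_lt [IsLengthSpace X] {x y : X} {s t : ℝ} (hs : 0 < s) (ht : 0 < t)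
    (h : dist x y < s + t) : ∃ m, dist x m < s ∧ dist m y < t := by
  by_cases hxy : dist x y < s
  · exact ⟨y, hxy, by simpa using ht⟩
  push Not at hxy
  obtain ⟨c, hc⟩ := exists_path_length_lt (edist_lt_ofReal.2 h)
  have hL : ∀ u : I, dist x (c u) + dist (c u) y < s + t := by
    intro u
    have := (edist_add_edist_le_pathLength c u).trans_lt hc
    rw [edist_dist, edist_dist, ← ENNReal.ofReal_add dist_nonneg dist_nonneg] at this
    exact (ENNReal.ofReal_lt_ofReal_iff (by positivity)).1 this
  -- The point `m` lies on `c`, at a distance from `x` slightly smaller than `s`.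
  obtain ⟨L, hL1, hL2⟩ : ∃ L < s + t, ∀ u : I, dist x (c u) + dist (c u) y ≤ L := by
    refine ⟨(pathLength c).toReal, ?_, fun u => ?_⟩
    · rw [← ENNReal.toReal_ofReal (show 0 ≤ s + t by positivity)]
      exact (ENNReal.toReal_lt_toReal hc.ne_top ENNReal.ofReal_ne_top).2 hc
    · have := edist_add_edist_le_pathLength c u
      rw [edist_dist, edist_dist, ← ENNReal.ofReal_add dist_nonneg dist_nonneg] at this
      exact (ENNReal.ofReal_le_iff_le_toReal hc.ne_top).1 this
  obtain ⟨s', h1, h2⟩ := exists_between (show max 0 (L - t) < s from max_lt hs (by linarith))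
  obtain ⟨h0, h1⟩ := max_lt_iff.1 h1
  have hcont : Continuous fun u : I => dist x (c u) := by fun_prop
  obtain ⟨u, hu⟩ : s' ∈ range fun u : I => dist x (c u) := by
    refine mem_range_of_exists_le_of_exists_ge hcont ⟨0, ?_⟩ ⟨1, ?_⟩
    · simpa using h0.le
    · simpa using h2.le.trans hxy
  simp only at hu
  exact ⟨c u, by linarith, by linarith [hL2 u]⟩

/-- The Hopf–Rinow theorem: a complete locally compact length space is proper. If the closed balls
about `x` of radius `< ρ` are compact, so is the one of radius `ρ`, being complete and totally
bounded; by local compactness it then has a compact neighbourhood that contains a larger ball. -/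
theorem properSpace_of_isLengthSpace [CompleteSpace X] [LocallyCompactSpace X]
    [IsLengthSpace X] : ProperSpace X := by
  refine ⟨fun x R => ?_⟩
  by_contra hR
  have hR0 : 0 ≤ R := by
    by_contra h
    exact hR (by rw [closedBall_eq_empty.2 (not_le.1 h)]; exact isCompact_empty)
  let A : Set ℝ := {r | 0 ≤ r ∧ IsCompact (closedBall x r)}
  have hA0 : (0 : ℝ) ∈ A := ⟨le_rfl, by simp⟩
  have hdown : ∀ r s, IsCompact (closedBall x r) → s ≤ r → IsCompact (closedBall x s) :=
    fun r s h hs => h.of_isClosed_subset isClosed_closedBall (closedBall_subset_closedBall hs)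
  have hAR : ∀ r ∈ A, r ≤ R := fun r hr => by
    by_contra h
    exact hR (hdown r R hr.2 (not_le.1 h).le)
  have hbdd : BddAbove A := ⟨R, hAR⟩
  set ρ := sSup A with hρ
  have hρ0 : 0 ≤ ρ := le_csSup hbdd hA0
  have hlt : ∀ s < ρ, IsCompact (closedBall x s) := by
    intro s hs
    obtain ⟨r, hr, hsr⟩ := exists_lt_of_lt_csSup ⟨0, hA0⟩ hs
    exact hdown r s hr.2 hsr.le
  have hcpt : IsCompact (closedBall x ρ) := by
    rcases hρ0.eq_or_lt with h | hpos
    · rw [← h]; exact hA0.2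
    refine TotallyBounded.isCompact_of_isClosed ?_ isClosed_closedBall
    rw [Metric.totallyBounded_iff]
    intro ε hε
    set η := min (ε / 4) (ρ / 2) with hη
    have hη0 : 0 < η := lt_min (by positivity) (by positivity)
    have hη1 : η ≤ ε / 4 := min_le_left _ _
    have hη2 : η ≤ ρ / 2 := min_le_right _ _
    obtain ⟨T, hT, hcov⟩ := Metric.totallyBounded_iff.1
      (hlt (ρ - η) (by linarith)).totallyBounded (ε / 2) (by positivity)
    refine ⟨T, hT, fun y hy => ?_⟩
    have hy' : dist x y ≤ ρ := by rw [dist_comm]; exact hy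
    obtain ⟨m, hm1, hm2⟩ := exists_dist_lt_dist_lt (x := x) (y := y) (s := ρ - η) (t := 2 * η)
      (by linarith) (by linarith) (by linarith)
    have := hcov (show m ∈ closedBall x (ρ - η) by
      rw [mem_closedBall, dist_comm]; exact hm1.le)
    simp only [mem_iUnion, mem_ball, exists_prop] at this ⊢
    obtain ⟨q, hq, hmq⟩ := this
    refine ⟨q, hq, ?_⟩
    have := dist_triangle y m q
    rw [dist_comm y m] at this
    linarith
  obtain ⟨η, hη, hthick⟩ := hcpt.exists_isCompact_cthickening
  have hbig : ρ + η / 2 ∈ A := by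
    refine ⟨by positivity, hthick.of_isClosed_subset isClosed_closedBall fun y hy => ?_⟩
    have hy' : dist x y ≤ ρ + η / 2 := by rw [dist_comm]; exact hy
    rcases hρ0.eq_or_lt with h | hpos
    · refine mem_cthickening_of_dist_le y x η _ (mem_closedBall_self hρ0) ?_
      rw [mem_closedBall] at hy
      linarith
    · obtain ⟨m, hm1, hm2⟩ := exists_dist_lt_dist_lt (x := x) (y := y) (s := ρ) (t := η)
        hpos hη (by linarith)
      refine mem_cthickening_of_dist_le y m η _ ?_ ?_
      · rw [mem_closedBall, dist_comm]; exact hm1.le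
      · rw [dist_comm]; exact hm2.le
  linarith [le_csSup hbdd hbig]

end LengthSpace

/-! ### Local isometries with a uniform radius -/

section UniformLocalIsometry

variable {E B : Type u} [MetricSpace E] [MetricSpace B]

/-- A map that preserves distances less than `ρ` and maps the ball of radius `ρ` about any point
onto the ball of radius `ρ` about its image. -/
structure IsUniformLocalIsometry (f : E → B) (ρ : ℝ) : Prop where
  pos : 0 < ρ
  dist_eq : ∀ {a b : E}, dist a b < ρ → dist (f a) (f b) = dist a b
  exists_dist_lt : ∀ {e : E} {u : B}, dist (f e) u < ρ → ∃ e', f e' = u ∧ dist e e' < ρ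

namespace IsUniformLocalIsometry

variable {f : E → B} {ρ : ℝ} (hf : IsUniformLocalIsometry f ρ)
include hf

theorem exists_dist_eq {e : E} {u : B} (h : dist (f e) u < ρ) :
    ∃ e', f e' = u ∧ dist e e' = dist (f e) u := by
  obtain ⟨e', rfl, he'⟩ := hf.exists_dist_lt h
  exact ⟨e', rfl, (hf.dist_eq he').symm⟩

theorem continuous : Continuous f := by
  rw [Metric.continuous_iff]
  intro b ε hε
  refine ⟨min ε ρ, lt_min hε hf.pos, fun a ha => ?_⟩
  rw [hf.dist_eq (ha.trans_le (min_le_right _ _))]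
  exact ha.trans_le (min_le_left _ _)

theorem isMetricCovering (hs : Function.Surjective f) : IsMetricCovering f := by
  have hρ := hf.pos
  refine ⟨?_, hs, fun e => ⟨ρ / 2, by linarith, fun a ha b hb => hf.dist_eq ?_⟩⟩
  · have hne : ∀ b : B, Nonempty (f ⁻¹' {b}) := fun b => let ⟨e, he⟩ := hs b; ⟨⟨e, he⟩⟩
    have hNE : Nonempty (B → E) := ⟨fun b => (hs b).choose⟩
    have hdist : ∀ (b : B) (i j : f ⁻¹' {b}), dist (i : E) j < ρ → i = j := by
      rintro b ⟨i, hi⟩ ⟨j, hj⟩ h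
      have h2 := hf.dist_eq h
      simp only [mem_preimage, mem_singleton_iff] at hi hj
      rw [hi, hj, dist_self] at h2
      exact Subtype.ext (dist_eq_zero.1 h2.symm)
    have hdisc : ∀ b : B, DiscreteTopology (f ⁻¹' {b}) := by
      intro b
      refine discreteTopology_iff_isOpen_singleton.2 fun i => ?_
      rw [Metric.isOpen_singleton_iff]
      exact ⟨ρ, hρ, fun j hj => hdist b j i hj⟩
    refine IsCoveringMap.mk f (fun b => f ⁻¹' {b}) (fun b =>
      IsOpen.trivializationDiscrete (f := f) (fun i : f ⁻¹' {b} => ball (i : E) (ρ / 2))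
        (ball b (ρ / 2)) isOpen_ball ?_ ?_ ?_ ?_ ?_) (fun b => mem_ball_self (by linarith))
    · rintro ⟨i, rfl⟩ W hW
      refine ⟨fun h => (h.preimage hf.continuous).inter isOpen_ball, fun h => ?_⟩
      rw [Metric.isOpen_iff] at h ⊢
      intro w hw
      obtain ⟨e, rfl, he⟩ := hf.exists_dist_eq (e := i) (u := w) (by
        have := hW hw
        rw [mem_ball, dist_comm] at this
        linarith)
      obtain ⟨ε, hε, hball⟩ := h e ⟨hw, by
        rw [mem_ball, dist_comm, he, dist_comm]; exact hW hw⟩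
      refine ⟨min ε ρ, lt_min hε hρ, fun u hu => ?_⟩
      rw [mem_ball, dist_comm, lt_min_iff] at hu
      obtain ⟨e', rfl, he'⟩ := hf.exists_dist_eq hu.2
      refine (hball ?_).1
      rw [mem_ball, dist_comm, he']
      exact hu.1
    · intro i a ha b hb hab
      have h : dist a b < ρ := by
        have := dist_triangle_right a b i
        rw [mem_ball] at ha hb
        linarith
      have := hf.dist_eq h
      rw [hab, dist_self] at this
      exact dist_eq_zero.1 this.symm
    · rintro ⟨i, rfl⟩ u hu
      rw [mem_ball, dist_comm] at hu
      obtain ⟨e, rfl, he⟩ := hf.exists_dist_eq (e := i) (u := u) (by linarith)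
      exact ⟨e, by rw [mem_ball, dist_comm, he]; exact hu, rfl⟩
    · intro i j hij
      refine Set.disjoint_left.2 fun a ha hb => hij (hdist b i j ?_)
      have := dist_triangle_left (i : E) j a
      rw [mem_ball] at ha hb
      linarith
    · intro e he
      rw [mem_preimage, mem_ball] at he
      obtain ⟨i, hi, hei⟩ := hf.exists_dist_eq (e := e) (u := b) (by linarith)
      exact mem_iUnion.2 ⟨⟨i, hi⟩, by rw [mem_ball, hei]; exact he⟩
  · have := dist_triangle_right a b e
    rw [mem_ball] at ha hb
    linarith

theorem completeSpace [CompleteSpace B] : CompleteSpace E := by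
  have hρ := hf.pos
  refine Metric.complete_of_cauchySeq_tendsto fun v hv => ?_
  obtain ⟨N, hN⟩ := Metric.cauchySeq_iff.1 hv (ρ / 2) (by linarith)
  have hfv : CauchySeq (f ∘ v) := by
    rw [Metric.cauchySeq_iff] at hv ⊢
    intro ε hε
    obtain ⟨M, hM⟩ := hv (min ε ρ) (lt_min hε hρ)
    refine ⟨M, fun m hm n hn => ?_⟩
    have h := lt_min_iff.1 (hM m hm n hn)
    simp only [Function.comp_apply]
    rw [hf.dist_eq h.2]
    exact h.1
  obtain ⟨y, hy⟩ := cauchySeq_tendsto_of_complete hfv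
  have hNy : dist (f (v N)) y ≤ ρ / 2 := by
    refine le_of_tendsto (tendsto_const_nhds.dist hy) ?_
    filter_upwards [eventually_ge_atTop N] with n hn
    have h := hN N le_rfl n hn
    simp only [Function.comp_apply]
    rw [hf.dist_eq (by linarith)]
    exact h.le
  obtain ⟨e, rfl, he⟩ := hf.exists_dist_eq (e := v N) (u := y) (by linarith)
  refine ⟨e, tendsto_iff_dist_tendsto_zero.2 ?_⟩
  refine (tendsto_iff_dist_tendsto_zero.1 hy).congr' ?_
  filter_upwards [eventually_ge_atTop N] with n hn
  refine hf.dist_eq ?_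
  have := dist_triangle (v n) (v N) e
  linarith [hN n hn N le_rfl]

theorem locallyCompactSpace [ProperSpace B] : LocallyCompactSpace E := by
  have hρ := hf.pos
  have hcpt : ∀ e : E, IsCompact (closedBall e (ρ / 4)) := by
    intro e
    have key : ∀ u : closedBall (f e) (ρ / 4), ∃ e', f e' = u ∧ dist e e' = dist (f e) u := by
      rintro ⟨u, hu⟩
      rw [mem_closedBall, dist_comm] at hu
      exact hf.exists_dist_eq (by simp only; linarith)
    choose g hg hg' using key
    have hiso : Isometry g := by
      refine Isometry.of_dist_eq fun u v => ?_
      have hu := u.2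
      have hv := v.2
      rw [mem_closedBall, dist_comm] at hu hv
      rw [← hf.dist_eq, hg, hg, Subtype.dist_eq]
      have := dist_triangle_left (g u) (g v) e
      rw [hg', hg'] at this
      linarith
    have himg : closedBall e (ρ / 4) = range g := by
      ext a
      constructor
      · intro ha
        rw [mem_closedBall] at ha
        have hfa : dist (f a) (f e) = dist a e := hf.dist_eq (by linarith)
        refine ⟨⟨f a, by rw [mem_closedBall, hfa]; exact ha⟩, ?_⟩
        set w : closedBall (f e) (ρ / 4) := ⟨f a, by rw [mem_closedBall, hfa]; exact ha⟩ with hw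
        have h1 : dist e (g w) = dist a e := by rw [hg', ← hfa, dist_comm]
        have h2 : dist (g w) a < ρ := by
          have := dist_triangle_left (g w) a e
          rw [h1, dist_comm e a] at this
          linarith
        have h3 := hf.dist_eq h2
        rw [hg, hw, dist_self] at h3
        exact dist_eq_zero.1 h3.symm
      · rintro ⟨u, rfl⟩
        rw [mem_closedBall, dist_comm, hg', dist_comm]
        exact u.2
    rw [himg]
    have : CompactSpace (closedBall (f e) (ρ / 4)) :=
      isCompact_iff_compactSpace.1 (isCompact_closedBall _ _)
    exact isCompact_range hiso.continuous
  have : WeaklyLocallyCompactSpace E :=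
    ⟨fun e => ⟨_, hcpt e, closedBall_mem_nhds e (by linarith)⟩⟩
  infer_instance

end IsUniformLocalIsometry

end UniformLocalIsometry

/-! ### Lifted length metrics -/

/-- A congruence is trivial on balls of radius `δ` if it relates any two paths with the same end
points that lie in a common ball of radius `δ`. -/
def PathCongruence.TrivialOnBalls {X : Type u} [MetricSpace X] (K : PathCongruence X) (δ : ℝ) :
    Prop :=
  ∀ ⦃q a b : X⦄ ⦃c c' : Path a b⦄, range c ⊆ ball q δ → range c' ⊆ ball q δ → K.rel c c'

theorem range_subset_ball_of_length_lt {X : Type u} [MetricSpace X] {x y : X} {c : Path x y}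
    {r : ℝ} (h : pathLength c < ENNReal.ofReal r) : range c ⊆ ball x r := by
  rintro _ ⟨t, rfl⟩
  have := edist_le_pathLength c t 0
  rw [c.source] at this
  exact edist_lt_ofReal.1 (this.trans_lt h)

/-- Path lifting to a metric space `E` carrying the length metric lifted from `X`: the distance
between two points is the infimum of the lengths of the paths whose lifts join them. -/
structure LengthLifting {X : Type u} [MetricSpace X] (K : PathCongruence X) (E : Type u)
    [MetricSpace E] extends PathLifting K E where
  edist_le_length : ∀ {a b : X} {c : Path a b} {e e' : E}, Lift c e e' →
    edist e e' ≤ pathLength c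
  exists_lift_length_lt : ∀ {e e' : E} {r : ℝ≥0∞}, edist e e' < r →
    ∃ c : Path (proj e) (proj e'), Lift c e e' ∧ pathLength c < r

namespace PathLifting

variable {X : Type u} [TopologicalSpace X] {K K' K'' : PathCongruence X} {E E' E'' : Type u}
  {S : PathLifting K E} {S' : PathLifting K' E'} {S'' : PathLifting K'' E''}
  {f : E → E'} {g : E → E''}

theorem lift_cast {a b a' b' : X} {c : Path a b} {e e' : E} (h : S.Lift c e e') (ha : a' = a)
    (hb : b' = b) : S.Lift (c.cast ha hb) e e' := by
  subst ha hb
  exact h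

theorem lift_refl_of_proj_eq {a : X} {e : E} (h : S.proj e = a) : S.Lift (Path.refl a) e e := by
  subst h
  exact S.refl e

theorem isLiftMap_id : S.IsLiftMap S id := fun _ _ _ _ _ h => h

theorem IsLiftMap.proj_map (hf : S.IsLiftMap S' f) (e : E) : S'.proj (f e) = S.proj e :=
  S'.proj_source (hf (S.refl e))

theorem IsLiftMap.surjective (hf : S.IsLiftMap S' f) : Function.Surjective f := by
  intro u
  obtain ⟨e⟩ := S.nonempty
  obtain ⟨c, hc⟩ := S'.exists_path (f e) u
  obtain ⟨e', he'⟩ := S.exists_lift c e (hf.proj_map e).symm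
  exact ⟨e', S'.unique (hf he') hc⟩

/-- Points with the same image are joined by the lift of a loop that is trivial modulo the
congruence of the target. -/
theorem IsLiftMap.exists_loop (hf : S.IsLiftMap S' f) {a b : E} (h : f a = f b) :
    ∃ c : Path (S.proj a) (S.proj a), S.Lift c a b ∧ K'.rel c (Path.refl _) := by
  have hab : S.proj b = S.proj a := by rw [← hf.proj_map, ← hf.proj_map, h]
  obtain ⟨c, hc⟩ := S.exists_path a b
  have hc' := lift_cast hc rfl hab.symm
  refine ⟨_, hc', S'.rel (hf hc') ?_⟩
  rw [← h]
  exact hf (S.refl a)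

theorem IsLiftMap.map_eq (hf : S.IsLiftMap S' f) {a b : E}
    {c : Path (S.proj a) (S.proj a)} (hc : S.Lift c a b) (h : K'.rel c (Path.refl _)) :
    f a = f b :=
  S'.unique (hf (S.refl a)) (S'.of_rel h (hf hc))

theorem IsLiftMap.map_eq_of_le (hf : S.IsLiftMap S' f) (hg : S.IsLiftMap S'' g) (hK : K' ≤ K'')
    {a b : E} (h : f a = f b) : g a = g b := by
  obtain ⟨c, hc, hc'⟩ := hf.exists_loop h
  exact hg.map_eq hc (hK hc')

end PathLifting

namespace LengthLifting

open PathLifting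

variable {X : Type u} [MetricSpace X] {K K' : PathCongruence X} {E E' : Type u}
  [MetricSpace E] [MetricSpace E']

theorem exists_lift_length_lt' (S : LengthLifting K E) {e e' : E} {y : X} (hy : S.proj e' = y)
    {r : ℝ} (h : dist e e' < r) : ∃ c : Path (S.proj e) y, S.Lift c e e' ∧
      pathLength c < ENNReal.ofReal r := by
  subst hy
  exact S.exists_lift_length_lt (edist_lt_ofReal.2 h)

theorem dist_lt_of_length_lt (S : LengthLifting K E) {a b : X} {c : Path a b} {e e' : E} {r : ℝ}
    (h : S.Lift c e e') (hc : pathLength c < ENNReal.ofReal r) : dist e e' < r :=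
  edist_lt_ofReal.1 ((S.edist_le_length h).trans_lt hc)

theorem dist_map_le {S : LengthLifting K E} {S' : LengthLifting K' E'} {f : E → E'}
    (hf : S.IsLiftMap S'.toPathLifting f) (e e' : E) : dist (f e) (f e') ≤ dist e e' := by
  refine le_of_forall_gt fun r hr => ?_
  obtain ⟨c, hc, hcr⟩ := S.exists_lift_length_lt' rfl hr
  exact S'.dist_lt_of_length_lt (hf hc) hcr

theorem exists_lift_of_dist_lt {S : LengthLifting K E} {S' : LengthLifting K' E'} {f : E → E'}
    (hf : S.IsLiftMap S'.toPathLifting f) {e : E} {u : E'} {r : ℝ} (h : dist (f e) u < r) :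
    ∃ e', f e' = u ∧ dist e e' < r := by
  obtain ⟨c, hc, hcr⟩ := S'.exists_lift_length_lt' rfl h
  obtain ⟨e', he'⟩ := S.exists_lift c e (hf.proj_map e).symm
  exact ⟨e', S'.unique (hf he') hc, S.dist_lt_of_length_lt he' hcr⟩

/-- Two points over the same point of `X` that are both close to a third point agree: the short
paths leading to them lie in a ball on which the congruence is trivial. -/
theorem eq_of_dist_lt (S : LengthLifting K E) {δ : ℝ} (hK : K.TrivialOnBalls δ) {e a b : E}
    (hab : S.proj a = S.proj b) (ha : dist e a < δ) (hb : dist e b < δ) : a = b := by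
  obtain ⟨c, hc, hcl⟩ := S.exists_lift_length_lt' rfl ha
  obtain ⟨c', hc', hcl'⟩ := S.exists_lift_length_lt' hab.symm hb
  exact S.unique hc (S.of_rel (hK (range_subset_ball_of_length_lt hcl')
    (range_subset_ball_of_length_lt hcl)) hc')

theorem isUniformLocalIsometry {S : LengthLifting K E} {S' : LengthLifting K' E'} {f : E → E'}
    (hf : S.IsLiftMap S'.toPathLifting f) {δ : ℝ} (hδ : 0 < δ) (hK : K.TrivialOnBalls δ) :
    IsUniformLocalIsometry f δ where
  pos := hδ
  dist_eq {a b} h := by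
    refine le_antisymm (dist_map_le hf a b) (le_of_not_gt fun hlt => ?_)
    obtain ⟨b', hb', hlt'⟩ := exists_lift_of_dist_lt hf hlt
    have : b' = b := S.eq_of_dist_lt hK
      (by rw [← hf.proj_map, ← hf.proj_map, hb']) (hlt'.trans h) h
    rw [this] at hlt'
    exact lt_irrefl _ hlt'
  exists_dist_lt h := exists_lift_of_dist_lt hf h

theorem isMetricCovering {S : LengthLifting K E} {S' : LengthLifting K' E'} {f : E → E'}
    (hf : S.IsLiftMap S'.toPathLifting f) {δ : ℝ} (hδ : 0 < δ) (hK : K.TrivialOnBalls δ) :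
    IsMetricCovering f :=
  (isUniformLocalIsometry hf hδ hK).isMetricCovering hf.surjective

variable (X) in
/-- A length space as a space with path lifting over itself. -/
def self [IsLengthSpace X] [Nonempty X] : LengthLifting (PathCongruence.total X) X where
  proj := id
  Lift {a b} _ x y := x = a ∧ y = b
  nonempty := inferInstance
  proj_source h := h.1
  proj_target h := h.2
  exists_lift _ _ h := ⟨_, h, rfl⟩
  exists_path x y := by
    obtain ⟨c, -⟩ := exists_path_length_lt (edist_lt_top x y)
    exact ⟨c, rfl, rfl⟩
  trans h h' := ⟨h.1, h'.2⟩
  symm h := ⟨h.2, h.1⟩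
  unique h h' := h.2.trans h'.2.symm
  of_rel _ h := h
  rel _ _ := trivial
  edist_le_length := by
    rintro a b c _ _ ⟨rfl, rfl⟩
    exact edist_ends_le_pathLength c
  exists_lift_length_lt h := by
    obtain ⟨c, hc⟩ := exists_path_length_lt h
    exact ⟨c, ⟨rfl, rfl⟩, hc⟩

theorem isLiftMap_proj [IsLengthSpace X] [Nonempty X] (S : LengthLifting K E) :
    S.IsLiftMap (self X).toPathLifting S.proj :=
  fun _ _ _ _ _ h => ⟨S.proj_source h, S.proj_target h⟩

/-- If `c` has a lift from `e` to `e'` in the sense of the relation `Lift`, it has a continuous one,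
not longer than `c`. Small pieces of `c` are
congruent to short paths, hence the continuity of the lift; and the distance between two points
of the lift is at most the variation of `c` between them. -/
theorem exists_path_length_le [IsLengthSpace X] (S : LengthLifting K E) {δ : ℝ} (hδ : 0 < δ)
    (hK : K.TrivialOnBalls δ) {a b : X} {c : Path a b} {e e' : E} (h : S.Lift c e e') :
    ∃ l : Path e e', pathLength l ≤ pathLength c := by
  have hea : S.proj e = a := S.proj_source h
  have hex : ∀ t : I, ∃ u, S.Lift (c.subpath 0 t) e u := fun t =>
    S.exists_lift _ e (by rw [hea, c.source])
  choose l hl using hex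
  have hl' : ∀ s t : I, S.Lift (c.subpath s t) (l s) (l t) := fun s t => by
    have := S.trans (S.symm (hl s)) (hl t)
    rw [Path.symm_subpath] at this
    exact S.of_rel (K.of_homotopic ⟨Path.Homotopy.subpathTransSubpath c s 0 t⟩) this
  have hl0 : l 0 = e := by
    refine S.unique (hl 0) ?_
    rw [Path.subpath_self]
    exact lift_refl_of_proj_eq (hea.trans c.source.symm)
  have hl1 : l 1 = e' := by
    refine S.unique (hl 1) ?_
    rw [Path.subpath_zero_one]
    exact lift_cast h _ _
  have hcont : Continuous l := by
    rw [Metric.continuous_iff']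
    intro t ε hε
    have hr : 0 < min ε δ := lt_min hε hδ
    have hnhds : c ⁻¹' ball (c t) (min ε δ) ∈ 𝓝 t :=
      c.continuous.continuousAt.preimage_mem_nhds (ball_mem_nhds _ hr)
    have huIcc : Tendsto (fun s => uIcc t s) (𝓝 t) (𝓝 t).smallSets :=
      tendsto_const_nhds.uIcc tendsto_id
    filter_upwards [huIcc.eventually (eventually_smallSets_subset.2 hnhds)] with s hs
    have hd : dist (c t) (c s) < min ε δ := by
      rw [dist_comm]
      exact hs right_mem_uIcc
    obtain ⟨k, hk⟩ := exists_path_length_lt (edist_lt_ofReal.2 hd)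
    have hsub : range (c.subpath t s) ⊆ ball (c t) δ := by
      rw [Path.range_subpath]
      exact (image_subset_iff.2 hs).trans (ball_subset_ball (min_le_right _ _))
    have hk' := S.of_rel (hK hsub ((range_subset_ball_of_length_lt hk).trans
      (ball_subset_ball (min_le_right _ _)))) (hl' t s)
    rw [dist_comm]
    exact (S.dist_lt_of_length_lt hk' hk).trans_le (min_le_left _ _)
  refine ⟨⟨⟨l, hcont⟩, hl0, hl1⟩, ?_⟩
  have hvar : ∀ s t : I, s ≤ t → edist (l t) (l s) ≤ eVariationOn c (Icc s t) := by
    intro s t hst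
    rw [edist_comm]
    refine (S.edist_le_length (hl' s t)).trans ?_
    refine eVariationOn.comp_le_of_monotoneOn (f := c) (Icc.convexComb s t) ?_ ?_
    · intro x _ y _ hxy
      rw [← Subtype.coe_le_coe]
      have hxy' : (x : ℝ) ≤ y := hxy
      have hst' : (s : ℝ) ≤ t := hst
      simp only [Icc.coe_convexComb]
      nlinarith
    · intro x _
      have : Icc.convexComb s t x ∈ uIcc s t := by
        rw [← Path.range_subpathAux]
        exact mem_range_self x
      rwa [uIcc_of_le hst] at this
  refine iSup_le fun ⟨n, v, hv, _⟩ => ?_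
  calc ∑ i ∈ Finset.range n, edist (l (v (i + 1))) (l (v i))
      ≤ ∑ i ∈ Finset.range n, eVariationOn c (Icc (v i) (v (i + 1))) :=
        Finset.sum_le_sum fun i _ => hvar _ _ (hv i.le_succ)
    _ = eVariationOn c (Icc (v 0) (v n)) := eVariationOn.sum' c hv
    _ ≤ pathLength c := eVariationOn.mono _ (subset_univ _)

theorem isLengthSpace [IsLengthSpace X] (S : LengthLifting K E) {δ : ℝ} (hδ : 0 < δ)
    (hK : K.TrivialOnBalls δ) : IsLengthSpace E where
  edist_eq_iInf e e' := by
    refine le_antisymm (le_iInf fun c => edist_ends_le_pathLength c) ?_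
    refine le_of_forall_gt fun r hr => ?_
    obtain ⟨c, hc, hcr⟩ := S.exists_lift_length_lt hr
    obtain ⟨l, hl⟩ := S.exists_path_length_le hδ hK hc
    exact (iInf_le _ l).trans_lt (hl.trans_lt hcr)

end LengthLifting

/-! ### Existence of the cover with a given congruence -/

namespace SpanierCover

variable {X : Type u} [MetricSpace X]

theorem trivialOnBalls_of_ballCovering_le {δ : ℝ} (hδ : 0 < δ) {K : PathCongruence X}
    (hK : congruence (ballCovering X δ hδ) ≤ K) : K.TrivialOnBalls δ :=
  fun q _ _ _ _ hc hc' => hK (congruence_rel_of_range ⟨q, rfl⟩ hc hc')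

variable [IsLengthSpace X]

/-- The Spanier cover carries the lifted length metric. -/
def lengthLifting (𝒰 : OpenCovering X) (p : X) :
    LengthLifting (congruence 𝒰) (SpanierCover 𝒰 p) where
  toPathLifting := pathLifting 𝒰 p
  edist_le_length {a b c e e'} h := by
    obtain rfl := (pathLifting 𝒰 p).proj_source h
    obtain rfl := (pathLifting 𝒰 p).proj_target h
    have h' := pathLifting_lift_iff.1 h
    exact iInf₂_le (f := fun (c' : Path e.proj e'.proj) (_ : e.transport c' = e') =>
      pathLength c') c h'
  exists_lift_length_lt h := by
    obtain ⟨c, hc, hcr⟩ := exists_of_edist_lt h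
    exact ⟨c, pathLifting_lift_iff.2 hc, hcr⟩

end SpanierCover

/-- The lifted length distance. -/
def PathLifting.lengthEDist {X : Type u} [MetricSpace X] {K : PathCongruence X} {E : Type u}
    (S : PathLifting K E) (e e' : E) : ℝ≥0∞ :=
  ⨅ (c : Path (S.proj e) (S.proj e')) (_ : S.Lift c e e'), pathLength c

namespace PathLifting

variable {X : Type u} [MetricSpace X] {K : PathCongruence X} {E : Type u} (S : PathLifting K E)

theorem lengthEDist_le {a b : X} {c : Path a b} {e e' : E} (h : S.Lift c e e') :
    S.lengthEDist e e' ≤ pathLength c := by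
  obtain rfl := S.proj_source h
  obtain rfl := S.proj_target h
  exact iInf₂_le (f := fun (c' : Path (S.proj e) (S.proj e')) (_ : S.Lift c' e e') =>
    pathLength c') c h

theorem exists_lift_of_lengthEDist_lt {e e' : E} {r : ℝ≥0∞} (h : S.lengthEDist e e' < r) :
    ∃ c : Path (S.proj e) (S.proj e'), S.Lift c e e' ∧ pathLength c < r := by
  simpa only [lengthEDist, iInf_lt_iff, exists_prop] using h

theorem lengthEDist_triangle (e e' e'' : E) :
    S.lengthEDist e e'' ≤ S.lengthEDist e e' + S.lengthEDist e' e'' := by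
  refine ENNReal.le_of_forall_pos_le_add fun ε hε hfin => ?_
  have hfin' := ENNReal.add_lt_top.1 hfin
  have hε2 : ((ε / 2 : NNReal) : ℝ≥0∞) ≠ 0 := by
    exact_mod_cast (half_pos hε).ne'
  obtain ⟨c, hc, hcl⟩ := S.exists_lift_of_lengthEDist_lt (ENNReal.lt_add_right hfin'.1.ne hε2)
  obtain ⟨k, hk, hkl⟩ := S.exists_lift_of_lengthEDist_lt (ENNReal.lt_add_right hfin'.2.ne hε2)
  calc S.lengthEDist e e'' ≤ pathLength (c.trans k) := S.lengthEDist_le (S.trans hc hk)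
    _ ≤ pathLength c + pathLength k := pathLength_trans_le c k
    _ ≤ (S.lengthEDist e e' + (ε / 2 : NNReal)) + (S.lengthEDist e' e'' + (ε / 2 : NNReal)) :=
        add_le_add hcl.le hkl.le
    _ = S.lengthEDist e e' + S.lengthEDist e' e'' + ε := by
        rw [add_add_add_comm, ← ENNReal.coe_add, add_halves]

theorem lengthEDist_comm (e e' : E) : S.lengthEDist e e' = S.lengthEDist e' e := by
  have key : ∀ e e', S.lengthEDist e e' ≤ S.lengthEDist e' e := fun e e' =>
    le_iInf₂ fun c hc => (S.lengthEDist_le (S.symm hc)).trans (pathLength_symm_le c)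
  exact le_antisymm (key _ _) (key _ _)

theorem eq_of_lengthEDist_eq_zero {δ : ℝ} (hδ : 0 < δ) (hK : K.TrivialOnBalls δ) {e e' : E}
    (h : S.lengthEDist e e' = 0) : e = e' := by
  have hp : S.proj e = S.proj e' := by
    have : edist (S.proj e) (S.proj e') ≤ S.lengthEDist e e' :=
      le_iInf₂ fun c _ => edist_ends_le_pathLength c
    rw [h] at this
    exact edist_le_zero.1 this
  obtain ⟨c, hc, hcl⟩ := S.exists_lift_of_lengthEDist_lt
    (h.trans_lt (ENNReal.ofReal_pos.2 hδ))
  have hc' := lift_cast hc rfl hp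
  refine S.unique (S.refl e) (S.of_rel (hK (q := S.proj e) ?_ ?_) hc')
  · exact range_subset_ball_of_length_lt (c := c) hcl
  · rintro _ ⟨t, rfl⟩
    exact mem_ball_self hδ

/-- The distance is finite: any path is congruent to a rectifiable one, as this is so in the
`δ`-cover. -/
theorem lengthEDist_ne_top [IsLengthSpace X] {δ : ℝ} (hδ : 0 < δ)
    (hK : SpanierCover.congruence (ballCovering X δ hδ) ≤ K) (e e' : E) :
    S.lengthEDist e e' ≠ ⊤ := by
  obtain ⟨c, hc⟩ := S.exists_path e e'
  let T := SpanierCover.lengthLifting (ballCovering X δ hδ) (S.proj e)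
  obtain ⟨u, hu⟩ := T.exists_lift c (SpanierCover.base _ _) rfl
  obtain ⟨k, hk, hkl⟩ := T.exists_lift_length_lt (edist_lt_top (SpanierCover.base _ _) u)
  have hk' := lift_cast hk (b' := S.proj e') rfl (T.proj_target hu).symm
  exact ((S.lengthEDist_le (S.of_rel (hK (T.rel hu hk')) hc)).trans_lt hkl).ne

/-- The lifted length metric. -/
abbrev lengthMetricSpace [IsLengthSpace X] {δ : ℝ} (hδ : 0 < δ)
    (hK : SpanierCover.congruence (ballCovering X δ hδ) ≤ K) : MetricSpace E :=
  letI : EMetricSpace E :=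
    { edist := S.lengthEDist
      edist_self := fun e => le_antisymm
        ((S.lengthEDist_le (S.refl e)).trans (pathLength_refl _).le) zero_le
      edist_comm := S.lengthEDist_comm
      edist_triangle := S.lengthEDist_triangle
      eq_of_edist_eq_zero := fun h => S.eq_of_lengthEDist_eq_zero hδ
        (SpanierCover.trivialOnBalls_of_ballCovering_le hδ hK) h }
  EMetricSpace.toMetricSpace (S.lengthEDist_ne_top hδ hK)

end PathLifting

/-- The paths starting at `p` modulo a congruence. -/
def PathCongruence.Cover {X : Type u} [TopologicalSpace X] (K : PathCongruence X) (p : X) :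
    Type u :=
  Σ y : X, Quotient (⟨K.rel (a := p) (b := y), K.refl, K.symm, K.trans⟩ : Setoid (Path p y))

/-- Path lifting to the space of paths starting at `p` modulo a congruence. -/
def PathCongruence.coverLifting {X : Type u} [TopologicalSpace X] (K : PathCongruence X)
    (p : X) : PathLifting K (K.Cover p) :=
  .ofQuotient p (fun e => e.1) (fun {y} γ => ⟨y, Quotient.mk _ γ⟩) (fun _ => rfl)
    (fun ⟨_, q⟩ => by
      obtain ⟨γ, rfl⟩ := Quotient.exists_rep q
      exact ⟨γ, rfl⟩)
    (fun {y γ γ'} => by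
      constructor
      · intro h
        exact Quotient.exact (eq_of_heq (Sigma.mk.inj h).2)
      · intro h
        exact congrArg (Sigma.mk y) (Quotient.sound h))

theorem exists_lengthLifting {X : Type u} [MetricSpace X] [IsLengthSpace X] [Nonempty X] {δ : ℝ}
    (hδ : 0 < δ) {K : PathCongruence X}
    (hK : SpanierCover.congruence (ballCovering X δ hδ) ≤ K) :
    ∃ (Z : Type u) (_ : MetricSpace Z), Nonempty (LengthLifting K Z) := by
  let S := K.coverLifting (Classical.arbitrary X)
  let _ := S.lengthMetricSpace hδ hK
  exact ⟨K.Cover (Classical.arbitrary X), S.lengthMetricSpace hδ hK,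
    ⟨{ S with
        edist_le_length := S.lengthEDist_le
        exists_lift_length_lt := S.exists_lift_of_lengthEDist_lt }⟩⟩

/-! ### Pointed Gromov–Hausdorff convergence -/

/-- The balls about `z` are eventually isometric, through maps defined on `Z`, to the balls of
the same radius about `y i`. -/
def BallsEventuallyIsometric {ι : Type*} (Y : ι → Type u) [∀ i, MetricSpace (Y i)]
    (y : ∀ i, Y i) (l : Filter ι) (Z : Type u) [MetricSpace Z] (z : Z) : Prop :=
  ∀ r > 0, ∀ᶠ i in l, ∃ g : Z → Y i, g z = y i ∧
    (∀ a ∈ closedBall z r, ∀ b ∈ closedBall z r, dist (g a) (g b) = dist a b) ∧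
    ∀ u ∈ closedBall (y i) r, ∃ a ∈ closedBall z r, g a = u

section GromovHausdorff

variable {ι : Type*} {Y : ι → Type u} [∀ i, MetricSpace (Y i)] {y : ∀ i, Y i} {l : Filter ι}
  {Z : Type u} [MetricSpace Z] {z : Z}

theorem BallsEventuallyIsometric.pointedGHTendsto (h : BallsEventuallyIsometric Y y l Z z) :
    PointedGHTendsto Y y l Z z := by
  intro r hr ε hε
  filter_upwards [h r hr] with i ⟨g, hgz, hiso, hsurj⟩
  have hz : z ∈ closedBall z r := mem_closedBall_self hr.le
  choose f hf hgf using fun a : closedBall (y i) r => hsurj a a.2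
  have hinj : ∀ a ∈ closedBall z r, ∀ b ∈ closedBall z r, g a = g b → a = b := by
    intro a ha b hb hab
    have := hiso a ha b hb
    rw [hab, dist_self] at this
    exact dist_eq_zero.1 this.symm
  refine ⟨fun a => ⟨f a, hf a⟩, fun a ha => ?_, fun a b => ?_, fun c => ?_⟩
  · exact hinj _ (hf a) z hz (by rw [hgf, ha, hgz])
  · rw [Subtype.dist_eq, ← hiso _ (hf a) _ (hf b), hgf, hgf, Subtype.dist_eq, sub_self, abs_zero]
    exact hε
  · have hc : g c ∈ closedBall (y i) r := by
      rw [mem_closedBall, ← hgz, hiso _ c.2 _ hz]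
      exact c.2
    refine ⟨⟨g c, hc⟩, ?_⟩
    have : f ⟨g c, hc⟩ = c := hinj _ (hf _) _ c.2 (by rw [hgf])
    simpa only [Subtype.dist_eq, this, dist_self] using hε

/-- An isometry of proper spaces as the limit, along an ultrafilter, of Hausdorff approximations
between larger and larger balls. -/
theorem exists_isometryEquiv_of_approx {W : Type u} [MetricSpace W] [ProperSpace Z]
    [ProperSpace W] {w : W} (h : ℕ → Z → W) (hz : ∀ n, h n z = w)
    (hdist : ∀ n : ℕ, ∀ a ∈ closedBall z (n + 1), ∀ b ∈ closedBall z (n + 1),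
      |dist (h n a) (h n b) - dist a b| < 1 / ((n : ℝ) + 1))
    (hdense : ∀ n : ℕ, ∀ c ∈ closedBall w (n + 1), ∃ a ∈ closedBall z (n + 1),
      dist c (h n a) < 1 / ((n : ℝ) + 1)) : ∃ φ : Z ≃ᵢ W, φ z = w := by
  let U : Ultrafilter ℕ := hyperfilter ℕ
  have hU : (U : Filter ℕ) ≤ atTop := Nat.hyperfilter_le_atTop
  have hle1 : ∀ n : ℕ, 1 / ((n : ℝ) + 1) ≤ 1 := fun n => by
    rw [div_le_one (by positivity)]
    have := n.cast_nonneg (α := ℝ)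
    linarith
  have hsmall : Tendsto (fun n : ℕ => 1 / ((n : ℝ) + 1)) U (𝓝 0) :=
    tendsto_one_div_add_atTop_nhds_zero_nat.mono_left hU
  have hev : ∀ r : ℝ, ∀ᶠ n : ℕ in (U : Filter ℕ), r ≤ (n : ℝ) + 1 := fun r => by
    refine hU ?_
    filter_upwards [eventually_ge_atTop ⌈r⌉₊] with n hn
    have := (Nat.le_ceil r).trans (Nat.cast_le.2 hn)
    linarith
  have hmem : ∀ a : Z, ∀ᶠ n : ℕ in (U : Filter ℕ), a ∈ closedBall z (n + 1) := fun a => hev _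
  have hzm : ∀ n : ℕ, z ∈ closedBall z ((n : ℝ) + 1) := fun n =>
    mem_closedBall_self (by positivity)
  have hlim : ∀ a, ∃ b, Tendsto (fun n => h n a) U (𝓝 b) := by
    intro a
    have hin : ∀ᶠ n in (U : Filter ℕ), h n a ∈ closedBall w (dist a z + 1) := by
      filter_upwards [hmem a] with n hn
      have := (abs_lt.1 (hdist n a hn z (hzm n))).2
      rw [hz] at this
      rw [mem_closedBall]
      linarith [hle1 n]
    obtain ⟨b, -, hb⟩ := (isCompact_closedBall w (dist a z + 1)).ultrafilter_le_nhds'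
      (U.map fun n => h n a) hin
    exact ⟨b, hb⟩
  choose φ hφ using hlim
  have hiso : Isometry φ := by
    refine Isometry.of_dist_eq fun a b => ?_
    refine tendsto_nhds_unique ((hφ a).dist (hφ b)) ?_
    rw [tendsto_iff_dist_tendsto_zero]
    refine squeeze_zero' (Eventually.of_forall fun _ => dist_nonneg) ?_ hsmall
    filter_upwards [hmem a, hmem b] with n ha hb
    rw [Real.dist_eq]
    exact (hdist n a ha b hb).le
  have hsurj : Function.Surjective φ := by
    intro c
    have hex : ∀ n : ℕ, ∃ a, c ∈ closedBall w ((n : ℝ) + 1) →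
        a ∈ closedBall z ((n : ℝ) + 1) ∧ dist c (h n a) < 1 / ((n : ℝ) + 1) := by
      intro n
      by_cases hc : c ∈ closedBall w ((n : ℝ) + 1)
      · obtain ⟨a, ha, ha'⟩ := hdense n c hc
        exact ⟨a, fun _ => ⟨ha, ha'⟩⟩
      · exact ⟨z, fun h => absurd h hc⟩
    choose a ha using hex
    have ha' : ∀ᶠ n : ℕ in (U : Filter ℕ), a n ∈ closedBall z ((n : ℝ) + 1) ∧
        dist c (h n (a n)) < 1 / ((n : ℝ) + 1) := by
      filter_upwards [hev (dist c w)] with n hn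
      exact ha n hn
    have hin : ∀ᶠ n in (U : Filter ℕ), a n ∈ closedBall z (dist c w + 2) := by
      filter_upwards [ha'] with n hn
      have h1 := (abs_lt.1 (hdist n (a n) hn.1 z (hzm n))).1
      rw [hz] at h1
      rw [mem_closedBall]
      have h2 := dist_triangle_left (h n (a n)) w c
      linarith [hle1 n, hn.2]
    obtain ⟨b, -, hb⟩ := (isCompact_closedBall z (dist c w + 2)).ultrafilter_le_nhds'
      (U.map a) hin
    have hb' : Tendsto a U (𝓝 b) := hb
    refine ⟨b, dist_le_zero.1 ?_⟩
    have hlim0 : Tendsto (fun n : ℕ => (1 / ((n : ℝ) + 1) + dist b (a n)) +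
        1 / ((n : ℝ) + 1)) U (𝓝 ((0 + dist b b) + 0)) :=
      (hsmall.add (tendsto_const_nhds.dist hb')).add hsmall
    rw [dist_self, add_zero, add_zero] at hlim0
    -- `b`, `a n` have images near each other, and the image of `a n` is near `c`.
    refine le_of_tendsto_of_tendsto ((hφ b).dist tendsto_const_nhds) hlim0 ?_
    filter_upwards [ha', hmem b] with n hn hbn
    have h1 := (abs_lt.1 (hdist n b hbn (a n) hn.1)).2
    have h2 := dist_triangle_right (h n b) c (h n (a n))
    linarith [hn.2]
  refine ⟨⟨Equiv.ofBijective φ ⟨hiso.injective, hsurj⟩, hiso⟩, ?_⟩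
  refine tendsto_nhds_unique (hφ z) ?_
  simp only [hz]
  exact tendsto_const_nhds

theorem BallsEventuallyIsometric.exists_isometryEquiv [l.NeBot] [ProperSpace Z]
    (h : BallsEventuallyIsometric Y y l Z z) {W : Type u} [MetricSpace W] [ProperSpace W] {w : W}
    (hW : PointedGHTendsto Y y l W w) : ∃ φ : Z ≃ᵢ W, φ z = w := by
  have key : ∀ n : ℕ, ∃ k : Z → W, k z = w ∧
      (∀ a ∈ closedBall z ((n : ℝ) + 1), ∀ b ∈ closedBall z ((n : ℝ) + 1),
        |dist (k a) (k b) - dist a b| < 1 / ((n : ℝ) + 1)) ∧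
      ∀ c ∈ closedBall w ((n : ℝ) + 1), ∃ a ∈ closedBall z ((n : ℝ) + 1),
        dist c (k a) < 1 / ((n : ℝ) + 1) := by
    intro n
    have hr : (0 : ℝ) < (n : ℝ) + 1 := by positivity
    obtain ⟨i, ⟨g, hgz, hiso, hsurj⟩, f, hf0, hfd, hfs⟩ :=
      ((h _ hr).and (hW _ hr (1 / ((n : ℝ) + 1)) (by positivity))).exists
    have hz : z ∈ closedBall z ((n : ℝ) + 1) := mem_closedBall_self hr.le
    have hmaps : ∀ a ∈ closedBall z ((n : ℝ) + 1), g a ∈ closedBall (y i) ((n : ℝ) + 1) := by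
      intro a ha
      rw [mem_closedBall, ← hgz, hiso a ha z hz]
      exact ha
    classical
    let k : Z → W := fun a =>
      if ha : a ∈ closedBall z ((n : ℝ) + 1) then f ⟨g a, hmaps a ha⟩ else w
    have hk : ∀ a (ha : a ∈ closedBall z ((n : ℝ) + 1)), k a = f ⟨g a, hmaps a ha⟩ :=
      fun a ha => dif_pos ha
    refine ⟨k, ?_, fun a ha b hb => ?_, fun c hc => ?_⟩
    · rw [hk z hz]
      exact hf0 _ hgz
    · rw [hk a ha, hk b hb, ← hiso a ha b hb]
      exact hfd _ _
    · obtain ⟨⟨u, hu⟩, hcu⟩ := hfs ⟨c, hc⟩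
      obtain ⟨a, ha, rfl⟩ := hsurj u hu
      refine ⟨a, ha, ?_⟩
      rw [hk a ha]
      exact hcu
  choose k hkz hkd hks using key
  exact exists_isometryEquiv_of_approx k hkz hkd hks

end GromovHausdorff

/-! ### Convergence of covers to the cover of the intersection -/

namespace LengthLifting

variable {X : Type u} [MetricSpace X]

/-- A lift preserving map that is injective on a ball of radius more than `3 r` identifies
isometrically the concentric balls of radius `r`. -/
theorem isometric_on_ball_of_injOn {K K' : PathCongruence X} {E E' : Type u}
    [MetricSpace E] [MetricSpace E'] {S : LengthLifting K E} {S' : LengthLifting K' E'}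
    {f : E → E'} (hf : S.IsLiftMap S'.toPathLifting f) {z : E} {r s : ℝ} (hr : 0 < r)
    (hs : 3 * r ≤ s) (hinj : InjOn f (closedBall z s)) :
    (∀ a ∈ closedBall z r, ∀ b ∈ closedBall z r, dist (f a) (f b) = dist a b) ∧
      ∀ u ∈ closedBall (f z) r, ∃ a ∈ closedBall z r, f a = u := by
  constructor
  · intro a ha b hb
    refine le_antisymm (dist_map_le hf a b) (le_of_not_gt fun hlt => ?_)
    obtain ⟨b', hb', hlt'⟩ := exists_lift_of_dist_lt hf hlt
    rw [mem_closedBall] at ha hb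
    have h1 := dist_triangle_right a b z
    have h2 := dist_triangle_left b' z a
    have : b' = b := hinj (by rw [mem_closedBall]; linarith) (by rw [mem_closedBall]; linarith) hb'
    rw [this] at hlt'
    exact lt_irrefl _ hlt'
  · intro u hu
    rw [mem_closedBall, dist_comm] at hu
    obtain ⟨a, rfl, ha⟩ := exists_lift_of_dist_lt hf (e := z) (u := u) (r := s) (by linarith)
    refine ⟨a, ?_, rfl⟩
    rw [mem_closedBall, dist_comm]
    -- Otherwise a path from `f z` to `f a` shorter than `dist z a` lifts to one from `z` to a
    -- point nearer to `z` than `a`, against injectivity.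
    refine le_of_not_gt fun hlt => ?_
    obtain ⟨a', ha', hlt'⟩ := exists_lift_of_dist_lt hf (hu.trans_lt hlt)
    have : a' = a := hinj (by rw [mem_closedBall, dist_comm]; linarith)
      (by rw [mem_closedBall, dist_comm]; exact ha.le) ha'
    rw [this] at hlt'
    exact lt_irrefl _ hlt'

variable {K : ℝ → PathCongruence X} {L : PathCongruence X} {Z : Type u} [MetricSpace Z]
  {Y : ℝ → Type u} [∀ R, MetricSpace (Y R)] {S : LengthLifting L Z}
  {T : ∀ R, LengthLifting (K R) (Y R)} {g : ∀ R, Z → Y R}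

/-- Two sequences of points of a ball of `Z` with the same image in `Y R` for larger and
larger `R` have subsequences with a common limit, and two close points with the same image agree. -/
theorem exists_injOn_closedBall [ProperSpace Z] (hK : ∀ {R R'}, R ≤ R' → K R' ≤ K R)
    (hL : PathCongruence.inter K ≤ L) {δ : ℝ}
    (hδ : 0 < δ) (hδL : L.TrivialOnBalls δ)
    (hg : ∀ R, S.IsLiftMap (T R).toPathLifting (g R)) (z : Z) (r : ℝ) :
    ∃ R₀, ∀ R ≥ R₀, InjOn (g R) (closedBall z r) := by
  by_contra! hcon
  have hex : ∀ n : ℕ, ∃ a ∈ closedBall z r, ∃ b ∈ closedBall z r, a ≠ b ∧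
      ∃ R ≥ (n : ℝ), g R a = g R b := by
    intro n
    obtain ⟨R, hR, hinj⟩ := hcon n
    simp only [InjOn, not_forall] at hinj
    obtain ⟨a, ha, b, hb, hab, hne⟩ := hinj
    exact ⟨a, ha, b, hb, hne, R, hR, hab⟩
  choose a ha b hb hne ρ hρ hab using hex
  have hloc : ∀ R, IsUniformLocalIsometry (g R) δ := fun R =>
    isUniformLocalIsometry (hg R) hδ hδL
  let U : Ultrafilter ℕ := hyperfilter ℕ
  have hU : (U : Filter ℕ) ≤ atTop := Nat.hyperfilter_le_atTop
  obtain ⟨x, -, hx⟩ := (isCompact_closedBall z r).ultrafilter_le_nhds' (U.map a)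
    (Eventually.of_forall ha : ∀ᶠ n in (U : Filter ℕ), a n ∈ closedBall z r)
  obtain ⟨y, -, hy⟩ := (isCompact_closedBall z r).ultrafilter_le_nhds' (U.map b)
    (Eventually.of_forall hb : ∀ᶠ n in (U : Filter ℕ), b n ∈ closedBall z r)
  have hx' : Tendsto a U (𝓝 x) := hx
  have hy' : Tendsto b U (𝓝 y) := hy
  have hgxy : ∀ R, g R x = g R y := by
    intro R
    refine tendsto_nhds_unique (((hloc R).continuous.tendsto x).comp hx')
      ((((hloc R).continuous.tendsto y).comp hy').congr' (hU ?_))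
    filter_upwards [eventually_ge_atTop ⌈R⌉₊] with n hn
    have hRn : R ≤ ρ n := ((Nat.le_ceil R).trans (Nat.cast_le.2 hn)).trans (hρ n)
    exact ((hg (ρ n)).map_eq_of_le (hg R) (hK hRn) (hab n)).symm
  have hxy : x = y := by
    obtain ⟨c, hc, -⟩ := (hg 0).exists_loop (hgxy 0)
    refine (PathLifting.isLiftMap_id (S := S.toPathLifting)).map_eq hc (hL fun R => ?_)
    refine (T R).rel (e := g R x) (e' := g R x) ?_ (hg R (S.refl x))
    have := hg R hc
    rwa [← hgxy R] at this
  rw [← hxy] at hy'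
  have hd : Tendsto (fun n => dist (a n) (b n)) U (𝓝 (dist x x)) := hx'.dist hy'
  rw [dist_self] at hd
  obtain ⟨n, hn⟩ := (hd.eventually_lt_const hδ).exists
  have := (hloc (ρ n)).dist_eq hn
  rw [hab n, dist_self] at this
  exact hne n (dist_eq_zero.1 this.symm)

/-- The covers with congruences `K R` have eventually the same balls as the one with the
intersection of the `K R`; no approximation is involved. -/
theorem ballsEventuallyIsometric [ProperSpace Z] (hK : ∀ {R R'}, R ≤ R' → K R' ≤ K R)
    (hL : PathCongruence.inter K ≤ L) {δ : ℝ}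
    (hδ : 0 < δ) (hδL : L.TrivialOnBalls δ)
    (hg : ∀ R, S.IsLiftMap (T R).toPathLifting (g R)) {z : Z} {y : ∀ R, Y R}
    (hz : ∀ R, g R z = y R) : BallsEventuallyIsometric Y y atTop Z z := by
  intro r hr
  obtain ⟨R₀, hR₀⟩ := exists_injOn_closedBall hK hL hδ hδL hg z (3 * r)
  filter_upwards [eventually_ge_atTop R₀] with R hR
  obtain ⟨h1, h2⟩ := isometric_on_ball_of_injOn (hg R) hr le_rfl (hR₀ R hR)
  exact ⟨g R, hz R, h1, by rwa [hz R] at h2⟩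

end LengthLifting

/-! ### The cut-off coverings -/

section Cutoff

variable {X : Type u} [MetricSpace X] {δ : ℝ} (hδ : 0 < δ)

/-- The congruence of the `R` cut-off `δ`-cover based at `x`. -/
def cutoffCongruence (x : X) (R : ℝ) : PathCongruence X :=
  SpanierCover.congruence (cutoffCovering δ hδ R x)

theorem cutoffCongruence_le {x x' : X} {R R' : ℝ} (h : closedBall x R ⊆ closedBall x' R') :
    cutoffCongruence hδ x' R' ≤ cutoffCongruence hδ x R := by
  refine SpanierCover.congruence_mono ?_
  rintro U (hU | rfl)
  · exact ⟨U, Or.inl hU, subset_rfl⟩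
  · exact ⟨_, Or.inr rfl, compl_subset_compl.2 h⟩

theorem ballCovering_congruence_le (x : X) (R : ℝ) :
    SpanierCover.congruence (ballCovering X δ hδ) ≤ cutoffCongruence hδ x R := by
  refine SpanierCover.congruence_mono ?_
  intro U hU
  exact ⟨U, Or.inl hU, subset_rfl⟩

/-- The intersection of the cut-off congruences does not depend on the base point. -/
theorem inter_cutoffCongruence_le (x x' : X) :
    PathCongruence.inter (cutoffCongruence hδ x) ≤
      PathCongruence.inter (cutoffCongruence hδ x') :=
  fun h R => cutoffCongruence_le hδ (closedBall_subset_closedBall' le_rfl) (h (R + dist x' x))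

end Cutoff

end

theorem proposition4p6 {X : Type u} [MetricSpace X] [CompleteSpace X] [LocallyCompactSpace X]
    [IsLengthSpace X] [Nonempty X] (δ : ℝ) (hδ : 0 < δ) :
    ∃ (Z : Type u) (_ : MetricSpace Z) (q : Z → X),
      CompleteSpace Z ∧ LocallyCompactSpace Z ∧ IsLengthSpace Z ∧ IsMetricCovering q ∧
      ∀ x : X, ∃ z : Z, q z = x ∧
        PointedGHTendsto (fun R : ℝ => CutoffDeltaCover δ hδ R x)
          (fun R => CutoffDeltaCover.base δ hδ R x) atTop Z z ∧
        (∀ (W : Type u) [MetricSpace W] [ProperSpace W] (w : W),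
          PointedGHTendsto (fun R : ℝ => CutoffDeltaCover δ hδ R x)
            (fun R => CutoffDeltaCover.base δ hδ R x) atTop W w →
          ∃ φ : Z ≃ᵢ W, φ z = w) ∧
        (∃ f : DeltaCover δ hδ x → Z, IsMetricCovering f ∧ f (DeltaCover.base δ hδ x) = z ∧
          ∀ e, q (f e) = e.proj) ∧
        ∀ R > 0, ∃ g : Z → CutoffDeltaCover δ hδ R x, IsMetricCovering g ∧
          g z = CutoffDeltaCover.base δ hδ R x ∧ ∀ a, (g a).proj = q a := by
  let p := Classical.arbitrary X
  have hball : SpanierCover.congruence (ballCovering X δ hδ) ≤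
      PathCongruence.inter (cutoffCongruence hδ p) := fun h R =>
    ballCovering_congruence_le hδ p R h
  have hK := SpanierCover.trivialOnBalls_of_ballCovering_le hδ hball
  obtain ⟨Z, mZ, ⟨S⟩⟩ := exists_lengthLifting hδ hball
  have : ProperSpace X := properSpace_of_isLengthSpace
  have hproj := LengthLifting.isUniformLocalIsometry S.isLiftMap_proj hδ hK
  have hcomplete : CompleteSpace Z := hproj.completeSpace
  have hlc : LocallyCompactSpace Z := hproj.locallyCompactSpace
  have hlength : IsLengthSpace Z := S.isLengthSpace hδ hK
  have hproper : ProperSpace Z := properSpace_of_isLengthSpace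
  have hcov := LengthLifting.isMetricCovering S.isLiftMap_proj hδ hK
  refine ⟨Z, mZ, S.proj, hcomplete, hlc, hlength, hcov, fun x => ?_⟩
  obtain ⟨z, hz⟩ := hcov.surjective x
  let T := fun R => SpanierCover.lengthLifting (cutoffCovering δ hδ R x) x
  let D := SpanierCover.lengthLifting (ballCovering X δ hδ) x
  have hle : ∀ R, PathCongruence.inter (cutoffCongruence hδ p) ≤ cutoffCongruence hδ x R :=
    fun R _ _ _ _ h => inter_cutoffCongruence_le hδ p x h R
  choose g hgz hg using fun R => S.exists_map (T R).toPathLifting (hle R) z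
    (CutoffDeltaCover.base δ hδ R x) hz.symm
  obtain ⟨f, hfz, hf⟩ := D.exists_map S.toPathLifting hball (DeltaCover.base δ hδ x) z hz
  have hballs : BallsEventuallyIsometric (fun R : ℝ => CutoffDeltaCover δ hδ R x)
      (fun R => CutoffDeltaCover.base δ hδ R x) atTop Z z :=
    LengthLifting.ballsEventuallyIsometric (K := cutoffCongruence hδ x) (T := T)
      (fun h => cutoffCongruence_le hδ (closedBall_subset_closedBall h))
      (inter_cutoffCongruence_le hδ x p) hδ hK hg hgz
  refine ⟨z, hz, hballs.pointedGHTendsto, fun W _ _ w hW => hballs.exists_isometryEquiv hW,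
    ⟨f, LengthLifting.isMetricCovering hf hδ ?_, hfz, hf.proj_map⟩, fun R _ =>
    ⟨g R, LengthLifting.isMetricCovering (hg R) hδ hK, hgz R, (hg R).proj_map⟩⟩
  exact SpanierCover.trivialOnBalls_of_ballCovering_le hδ fun h => h
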